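/- Let $AdS_3$ be $SL(2,\mathbb{R})=\{X\in M(2,\mathbb{R}):\det X=1\}$ with the Lorentzian metric of signature $(-,+,+)$ induced by the quadratic form $-\det$ on $M(2,\mathbb{R})$, time-oriented by the left-invariant timelike vector field $g\mapsto gJ$, $J=\begin{pmatrix}0&1\\-1&0\end{pmatrix}$. The group $SL(2,\mathbb{R})\times SL(2,\mathbb{R})$ acts on $AdS_3$ by time-orientation preserving isometries $(g_L,g_R)\cdot g=g_Lgg_R^{-1}$. Let $A$ be the subgroup of the pairs whose two components are of the form $\mathrm{diag}(e^t,e^{-t})$, $t\in\mathbb{R}$, let $\Omega\subset AdS_3$ be the union of the $A$-orbits that are spacelike surfaces, and write $R_\theta=\begin{pmatrix}\cos\theta&\sin\theta\\-\sin\theta&\cos\theta\end{pmatrix}$ (so that $\theta$ increases towards the future along $\theta\mapsto R_\theta$). A Cauchy surface of a spacetime is a spacelike hypersurface that every inextendable non-spacelike curve meets exactly once; a spacetime is globally hyperbolic if it has a Cauchy surface. The mean curvature of a spacelike hypersurface with future-pointing unit normal $n$ is the trace of $II(X,Y)=-\langle\nabla_Xn,Y\rangle$. A CMC time function is a submersion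 $\tau$ to $\mathbb{R}$, strictly increasing along every future-directed timelike curve, such that for every $s\in\mathbb{R}$ the fiber $\tau^{-1}(s)$ is a spacelike hypersurface of constant mean curvature $s$. Theorem. Let $U$ be a connected component of $\Omega$ and $\Gamma$ a lattice of $A$. Then $\Gamma$ preserves $U$ and the Torus Universe $M=\Gamma\backslash U$, with the structure for which the local sections of $U\to M$ are charts, is a (connected, Hausdorff) spacetime locally modelled on $AdS_3$. It is globally hyperbolic and admits a CMC time function. More precisely, for every $g\in U$ the $A$-orbit of $g$ is contained in $U$ and contains $R_\theta$ for exactly one $\theta\in[0,2\pi)$; its image in $M$ is a Cauchy surface with constant mean curvature $-2\cot(2\theta)$; and the function on $M$ whose value on the image of each such orbit is $-2\cot(2\theta)$ is a CMC time function. -/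

import Mathlib

noncomputable section

open Matrix Topology
open scoped ContDiff

namespace AdS

/-! ### The anti-de Sitter space as `SL(2,ℝ)` with the metric induced by `-det` -/

/-- The ambient vector space `M(2,ℝ)` of arrays of entries `X i j`, with the usual normed structure
of `ℝ⁴` (only used to speak of derivatives). -/
abbrev Mat := Fin 2 → Fin 2 → ℝ

/-- The three-dimensional anti-de Sitter space, i.e. the quadric `-det = -1` in `Mat`. -/
abbrev AdS3 := Matrix.SpecialLinearGroup (Fin 2) ℝ

/-- The inclusion of `AdS3` in `Mat`. -/
def mat (g : AdS3) : Mat := fun i j => (g : Matrix (Fin 2) (Fin 2) ℝ) i j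

/-- The ambient quadratic form. -/
def Q (X : Mat) : ℝ := -(Matrix.of X).det

/-- The symmetric bilinear form with `B X X = Q X`. -/
def B (X Y : Mat) : ℝ := (Q (X + Y) - Q X - Q Y) / 2

/-- `X` is tangent to the quadric at `g`. -/
def IsTangent (g : AdS3) (X : Mat) : Prop := B (mat g) X = 0

/-- The left-invariant unit timelike vector field defining the time orientation; along the
rotations `R_θ` it is the velocity `d R_θ / dθ`. -/
def timeField (g : AdS3) : Mat :=
  let J : Matrix (Fin 2) (Fin 2) ℝ := !![0, 1; -1, 0]
  fun i j => ((g : Matrix (Fin 2) (Fin 2) ℝ) * J) i j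

/-- Future-directed timelike tangent vectors. -/
def IsFutureTimelike (g : AdS3) (X : Mat) : Prop :=
  IsTangent g X ∧ Q X < 0 ∧ B X (timeField g) < 0

/-- Future-directed non-spacelike (i.e. timelike or lightlike, non-zero) tangent vectors. -/
def IsFutureNonspacelike (g : AdS3) (X : Mat) : Prop :=
  IsTangent g X ∧ X ≠ 0 ∧ Q X ≤ 0 ∧ B X (timeField g) < 0

/-- The `B`-orthogonal projection of `Mat` onto the tangent space at `g` (recall `Q g = -1`). -/
def tangentProj (g : AdS3) (Y : Mat) : Mat := Y + B (mat g) Y • mat g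

/-- The Levi-Civita derivative at `g`, in the direction `X`, of a vector field `N`: the tangential
projection of the flat derivative of the ambient space. -/
def covDeriv (g : AdS3) (N : Mat → Mat) (X : Mat) : Mat :=
  tangentProj g (fderiv ℝ N (mat g) X)

/-- Velocities at `g` of curves contained in a subset `S` of `AdS3`. -/
def IsTangentTo (S : Set AdS3) (g : AdS3) (X : Mat) : Prop :=
  ∃ c : ℝ → AdS3, c 0 = g ∧ (∀ᶠ t in 𝓝 0, c t ∈ S) ∧ HasDerivAt (fun t => mat (c t)) X 0

/-- `n` is the future-pointing unit normal vector at `g` of the surface `S`. -/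
def IsFutureUnitNormal (S : Set AdS3) (g : AdS3) (n : Mat) : Prop :=
  IsFutureTimelike g n ∧ Q n = -1 ∧ ∀ X, IsTangentTo S g X → B n X = 0

/-! ### Spacetimes locally modelled on `AdS3`

`𝒜` is a set of charts of `M` with values in `AdS3`. The metric, the time orientation and the
connection of `M` are those of `AdS3`, read in these charts. -/

section Spacetime

variable {M : Type*} [TopologicalSpace M] (𝒜 : Set (OpenPartialHomeomorph M AdS3))

/-- `M` with the charts `𝒜` is a (connected, Hausdorff, second countable) time-oriented Lorentzian
manifold locally modelled on `AdS3`: the charts cover `M`, and the changes of charts are locally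
the restrictions of isometries `x ↦ g_L x g_R⁻¹`. -/
structure IsSpacetime : Prop where
  hausdorff : T2Space M
  secondCountable : SecondCountableTopology M
  connected : ConnectedSpace M
  cover : ∀ x : M, ∃ e ∈ 𝒜, x ∈ e.source
  compat : ∀ e ∈ 𝒜, ∀ e' ∈ 𝒜, ∀ x ∈ e.source ∩ e'.source,
    ∃ gL gR : AdS3, ∀ᶠ y in 𝓝 x, e' y = gL * e y * gR⁻¹

/-- `γ`, restricted to the interval `I`, is a continuous curve which, except at a locally finite
set of parameters, has a velocity of the kind `P`. -/
def IsCurveOn (P : AdS3 → Mat → Prop) (γ : ℝ → M) (I : Set ℝ) : Prop :=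
  ContinuousOn γ I ∧ ∃ S : Set ℝ, (∀ a b, (S ∩ Set.Icc a b).Finite) ∧
    ∀ t ∈ interior I, t ∉ S → ∃ e ∈ 𝒜, γ t ∈ e.source ∧
      ∃ X : Mat, HasDerivAt (fun s => mat (e (γ s))) X t ∧ P (e (γ t)) X

/-- Inextendable non-spacelike curves, future- or past-directed, without endpoint in `M`. They are
parametrized by the whole real line, as every open interval can be. -/
def IsInextendableNonspacelikeCurve (γ : ℝ → M) : Prop :=
  (IsCurveOn 𝒜 IsFutureNonspacelike γ Set.univ ∨
    IsCurveOn 𝒜 IsFutureNonspacelike (fun t => γ (-t)) Set.univ) ∧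
  (¬ ∃ x, Filter.Tendsto γ Filter.atTop (𝓝 x)) ∧ ¬ ∃ x, Filter.Tendsto γ Filter.atBot (𝓝 x)

/-- `S` is a smooth embedded spacelike surface: near each of its points it is, in a chart, the zero
set of a smooth function `f` such that the kernel of `df` on the tangent space is positive
definite (in particular `df` does not vanish on the tangent space). -/
def IsSpacelikeSurface (S : Set M) : Prop :=
  ∀ p ∈ S, ∃ e ∈ 𝒜, p ∈ e.source ∧ ∃ (W : Set Mat) (f : Mat → ℝ),
    IsOpen W ∧ mat (e p) ∈ W ∧ ContDiffOn ℝ ∞ f W ∧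
    ∀ q ∈ e.source, mat (e q) ∈ W → (q ∈ S ↔ f (mat (e q)) = 0) ∧
      (q ∈ S → ∀ X : Mat, IsTangent (e q) X → X ≠ 0 → fderiv ℝ f (mat (e q)) X = 0 → 0 < Q X)

/-- The surface `S` has mean curvature `H` at `p`: in a chart, with `N` a smooth field restricting
to the future-pointing unit normal of `S`, the form `II(X,Y) = -⟨∇_X N, Y⟩` has trace `H`, computed
in an orthonormal basis `X, Y` of the tangent plane of `S` at `p`. -/
def HasMeanCurvatureAt (S : Set M) (p : M) (H : ℝ) : Prop :=
  ∃ e ∈ 𝒜, p ∈ e.source ∧ ∃ (W : Set Mat) (N : Mat → Mat),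
    IsOpen W ∧ mat (e p) ∈ W ∧ ContDiffOn ℝ ∞ N W ∧
    (∀ q ∈ e.source, q ∈ S → mat (e q) ∈ W →
      IsFutureUnitNormal (e '' (e.source ∩ S)) (e q) (N (mat (e q)))) ∧
    ∃ X Y : Mat, IsTangentTo (e '' (e.source ∩ S)) (e p) X ∧
      IsTangentTo (e '' (e.source ∩ S)) (e p) Y ∧
      Q X = 1 ∧ Q Y = 1 ∧ B X Y = 0 ∧
      H = -B (covDeriv (e p) N X) X + -B (covDeriv (e p) N Y) Y

/-- Spacelike surfaces with constant mean curvature `H`. -/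
def IsCMCSurface (S : Set M) (H : ℝ) : Prop :=
  IsSpacelikeSurface 𝒜 S ∧ ∀ p ∈ S, HasMeanCurvatureAt 𝒜 S p H

/-- Cauchy surfaces: spacelike surfaces met exactly once by every inextendable non-spacelike
curve. -/
def IsCauchySurface (S : Set M) : Prop :=
  IsSpacelikeSurface 𝒜 S ∧
    ∀ γ : ℝ → M, IsInextendableNonspacelikeCurve 𝒜 γ → ∃! t : ℝ, γ t ∈ S

/-- Global hyperbolicity: existence of a Cauchy surface. -/
def IsGloballyHyperbolic : Prop := ∃ S : Set M, IsCauchySurface 𝒜 S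

/-- Smooth submersions to the real line (a function on the quadric is smooth if it locally extends
to a smooth function on `Mat`). -/
def IsSubmersion (τ : M → ℝ) : Prop :=
  ∀ p : M, ∃ e ∈ 𝒜, p ∈ e.source ∧ ∃ (W : Set Mat) (F : Mat → ℝ),
    IsOpen W ∧ mat (e p) ∈ W ∧ ContDiffOn ℝ ∞ F W ∧
    (∀ q ∈ e.source, mat (e q) ∈ W → τ q = F (mat (e q))) ∧
    ∃ X : Mat, IsTangent (e p) X ∧ fderiv ℝ F (mat (e p)) X ≠ 0

/-- Time functions: submersions strictly increasing along future-directed timelike curves. -/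
def IsTimeFunction (τ : M → ℝ) : Prop :=
  IsSubmersion 𝒜 τ ∧ ∀ (γ : ℝ → M) (a b : ℝ), a < b →
    IsCurveOn 𝒜 IsFutureTimelike γ (Set.Icc a b) → τ (γ a) < τ (γ b)

/-- CMC time functions: the fiber over `H` is a spacelike surface of constant mean
curvature `H`. -/
def IsCMCTimeFunction (τ : M → ℝ) : Prop :=
  IsTimeFunction 𝒜 τ ∧ ∀ H : ℝ, IsCMCSurface 𝒜 (τ ⁻¹' {H}) H

end Spacetime

/-! ### Torus Universes -/

/-- The matrix `diag (e^t, e^{-t})`. -/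
def gpow (t : ℝ) : AdS3 := ⟨!![Real.exp t, 0; 0, Real.exp (-t)], by
  rw [Matrix.det_fin_two_of, ← Real.exp_add]; simp⟩

theorem gpow_add (s t : ℝ) : gpow (s + t) = gpow s * gpow t := by
  apply Subtype.ext
  change !![Real.exp (s + t), 0; 0, Real.exp (-(s + t))] =
    !![Real.exp s, 0; 0, Real.exp (-s)] * !![Real.exp t, 0; 0, Real.exp (-t)]
  simp [Real.exp_add, mul_comm]

theorem gpow_zero : gpow 0 = 1 := by
  apply Subtype.ext
  change !![Real.exp 0, 0; 0, Real.exp (-0)] = (1 : Matrix (Fin 2) (Fin 2) ℝ)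
  simp [Matrix.one_fin_two]

/-- The one-parameter group of the matrices `diag (e^t, e^{-t})`. -/
def diagHom : Multiplicative ℝ →* AdS3 where
  toFun t := gpow t.toAdd
  map_one' := gpow_zero
  map_mul' s t := gpow_add s.toAdd t.toAdd

/-- The pairs of elements of `SL(2,ℝ)` whose two components belong to the one-parameter group. -/
def A : Subgroup (AdS3 × AdS3) := diagHom.range.prod diagHom.range

/-- The isometric action `(g_L, g_R) . g = g_L g g_R⁻¹`. -/
def act (x : AdS3 × AdS3) (g : AdS3) : AdS3 := x.1 * g * x.2⁻¹

/-- The `A`-orbit of `g`. -/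
def orbitA (g : AdS3) : Set AdS3 := {h | ∃ x ∈ A, act x g = h}

/-- The `A`-orbit of `g` is a spacelike surface: all the velocities at `g` given by the non-zero
elements `(p, q)` of the Lie algebra of `A` are spacelike. -/
def OrbitIsSpacelike (g : AdS3) : Prop :=
  ∀ p q : ℝ, (p, q) ≠ (0, 0) →
    0 < Q (deriv (fun t : ℝ => mat (act (gpow (p * t), gpow (q * t)) g)) 0)

/-- The union of the spacelike `A`-orbits. -/
def Omega : Set AdS3 := {g | ∃ h, OrbitIsSpacelike h ∧ g ∈ orbitA h}

/-- Lattices of the vector group `A`: discrete cocompact subgroups. -/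
structure IsLatticeOfA (Γ : Subgroup (AdS3 × AdS3)) : Prop where
  le : Γ ≤ A
  discrete : DiscreteTopology Γ
  cocompact : CompactSpace (A ⧸ Γ.subgroupOf A)

/-- `U` is a connected component of `Omega`. -/
def IsComponentOfOmega (U : Set AdS3) : Prop :=
  ∃ g ∈ Omega, U = connectedComponentIn Omega g

/-- Two points of `U` are equivalent if they are in the same `Γ`-orbit. -/
def orbitSetoid (Γ : Subgroup (AdS3 × AdS3)) (U : Set AdS3) : Setoid U where
  r u v := ∃ x ∈ Γ, act x u.1 = v.1
  iseqv :=
    { refl := fun u => ⟨1, Γ.one_mem, by simp [act]⟩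
      symm := by
        rintro u v ⟨x, hx, h⟩
        exact ⟨x⁻¹, Γ.inv_mem hx, by rw [← h]; simp [act, mul_assoc]⟩
      trans := by
        rintro u v w ⟨x, hx, h⟩ ⟨y, hy, h'⟩
        exact ⟨y * x, Γ.mul_mem hy hx, by rw [← h', ← h]; simp [act, mul_assoc]⟩ }

/-- The quotient `Γ \ U`, with the quotient topology. -/
abbrev TorusUniverse (Γ : Subgroup (AdS3 × AdS3)) (U : Set AdS3) := Quotient (orbitSetoid Γ U)

/-- The projection `U → Γ \ U`. -/
def proj (Γ : Subgroup (AdS3 × AdS3)) (U : Set AdS3) (u : U) : TorusUniverse Γ U :=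
  Quotient.mk (orbitSetoid Γ U) u

/-- The charts of `Γ \ U`: the local sections of the projection `U → Γ \ U`. -/
def torusCharts (Γ : Subgroup (AdS3 × AdS3)) (U : Set AdS3) :
    Set (OpenPartialHomeomorph (TorusUniverse Γ U) AdS3) :=
  {e | ∀ x ∈ e.source, ∃ u : U, proj Γ U u = x ∧ e x = u.1}

/-- The image in `Γ \ U` of the `A`-orbit of `g`. -/
def orbitImage (Γ : Subgroup (AdS3 × AdS3)) (U : Set AdS3) (g : AdS3) :
    Set (TorusUniverse Γ U) :=
  proj Γ U '' {u | u.1 ∈ orbitA g}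

/-- The rotation `R_θ`. -/
def rot (θ : ℝ) : AdS3 :=
  ⟨!![Real.cos θ, Real.sin θ; -Real.sin θ, Real.cos θ], by
    rw [Matrix.det_fin_two_of]; nlinarith [Real.sin_sq_add_cos_sq θ]⟩

end AdS

end

noncomputable section

open Matrix Topology
open scoped ContDiff

namespace AdS

/-! ### Entries -/

/-! Write `g` with rows (a, b) and (c, d), and put P = ad, D = -bc, so that P + D = 1. The orbit of
`g` is spacelike exactly when P and D are positive (`orbitIsSpacelike_iff`), so the components of
`Omega` correspond to the four sign patterns of (a, b) (`connectedComponentIn_Omega`). On each of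
them, logarithms of the entries give global coordinates (T, X, Y) with values in ℝ³ (`coords_param`,
`param_coords`): `A` is the group of translations in (X, Y), and T labels the orbits. There D/P =
e^{2σT}, where σ = ±1 is the sign of ab, chosen so that T increases towards the future, and the
metric is P dX² + D dY² - PD dT² (`Q_eq_vel`). The quotient is thus ℝ times ℝ²/Γ, with T well
defined on it.

Causality: for a future causal vector, Cauchy-Schwarz with weights P and D gives |X'| ≤ T' and |Y'|
≤ T' (`velT_pos`). If T is bounded towards one end of a causal curve, then X and Y converge there
too and the curve has an endpoint. An inextendable causal curve therefore takes every value of T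
exactly once, and every level of T is a Cauchy surface (`isCauchySurface_level`).

Curvature: the unit normal of a level is the restriction of a linear map of the ambient space, equal
to -κ on diagonal entries and κ⁻¹ on off-diagonal ones, where κ = σe^{σT} = tan θ. A linear map is
its own derivative, so the principal curvatures are κ and -κ⁻¹, with sum tan θ - cot θ = -2 cot 2θ =
2 sinh T (`isCMCSurface_level`). As 2 sinh T is an increasing bijective function of T, it is the CMC
time function. -/

theorem Q_eq (X : Mat) : Q X = X 0 1 * X 1 0 - X 0 0 * X 1 1 := by
  simp [Q, Matrix.det_fin_two]

theorem B_eq (X Y : Mat) :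
    B X Y = (X 0 1 * Y 1 0 + Y 0 1 * X 1 0 - X 0 0 * Y 1 1 - Y 0 0 * X 1 1) / 2 := by
  simp only [B, Q_eq, Pi.add_apply]
  ring

theorem mat_det (g : AdS3) : mat g 0 0 * mat g 1 1 - mat g 0 1 * mat g 1 0 = 1 := by
  have := g.det_coe
  rwa [Matrix.det_fin_two] at this

theorem mat_injective : Function.Injective mat := fun g h hgh =>
  Subtype.ext (by ext i j; exact congrFun (congrFun hgh i) j)

theorem mat_ext {X Y : Mat} (h₀₀ : X 0 0 = Y 0 0) (h₀₁ : X 0 1 = Y 0 1) (h₁₀ : X 1 0 = Y 1 0)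
    (h₁₁ : X 1 1 = Y 1 1) : X = Y := by
  ext i j
  fin_cases i <;> fin_cases j <;> assumption

theorem continuous_mat : Continuous mat :=
  continuous_pi fun i => continuous_pi fun j =>
    (continuous_subtype_val (p := fun A : Matrix (Fin 2) (Fin 2) ℝ => A.det = 1)).matrix_elem i j

theorem timeField_eq (g : AdS3) :
    timeField g 0 0 = -mat g 0 1 ∧ timeField g 0 1 = mat g 0 0 ∧
      timeField g 1 0 = -mat g 1 1 ∧ timeField g 1 1 = mat g 1 0 := by
  simp [timeField, mat, Matrix.mul_apply, Fin.sum_univ_two]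

/-- The element of `A` acting on the entries by the factors `e^x`, `e^y`, `e^{-y}`, `e^{-x}`. -/
def flow (x y : ℝ) : AdS3 × AdS3 := (gpow ((x + y) / 2), gpow ((y - x) / 2))

theorem gpow_inv (t : ℝ) : (gpow t)⁻¹ = gpow (-t) := by
  rw [inv_eq_iff_mul_eq_one, ← gpow_add, add_neg_cancel, gpow_zero]

theorem mem_A_iff {z : AdS3 × AdS3} : z ∈ A ↔ ∃ x y, flow x y = z := by
  constructor
  · rintro ⟨⟨s, hs⟩, ⟨t, ht⟩⟩
    refine ⟨s.toAdd - t.toAdd, s.toAdd + t.toAdd, Prod.ext ?_ ?_⟩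
    · rw [← hs]
      change gpow _ = gpow _
      congr 1
      ring
    · rw [← ht]
      change gpow _ = gpow _
      congr 1
      ring
  · rintro ⟨x, y, rfl⟩
    exact ⟨⟨Multiplicative.ofAdd _, rfl⟩, ⟨Multiplicative.ofAdd _, rfl⟩⟩

theorem flow_mem_A (x y : ℝ) : flow x y ∈ A := mem_A_iff.2 ⟨x, y, rfl⟩

theorem mat_act_gpow (s t : ℝ) (g : AdS3) :
    mat (act (gpow s, gpow t) g) 0 0 = Real.exp (s - t) * mat g 0 0 ∧
      mat (act (gpow s, gpow t) g) 0 1 = Real.exp (s + t) * mat g 0 1 ∧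
      mat (act (gpow s, gpow t) g) 1 0 = Real.exp (-(s + t)) * mat g 1 0 ∧
      mat (act (gpow s, gpow t) g) 1 1 = Real.exp (-(s - t)) * mat g 1 1 := by
  have hs : ∀ i j, (gpow s : Matrix (Fin 2) (Fin 2) ℝ) i j =
    !![Real.exp s, 0; 0, Real.exp (-s)] i j := fun _ _ => rfl
  have ht : ∀ i j, (gpow (-t) : Matrix (Fin 2) (Fin 2) ℝ) i j =
    !![Real.exp (-t), 0; 0, Real.exp (- -t)] i j := fun _ _ => rfl
  simp only [mat, act, gpow_inv, Matrix.SpecialLinearGroup.coe_mul, Matrix.mul_apply,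
    Fin.sum_univ_two, hs, ht]
  simp [sub_eq_add_neg, Real.exp_add]
  refine ⟨?_, ?_, ?_, ?_⟩ <;> ring

theorem mat_act_flow (x y : ℝ) (g : AdS3) :
    mat (act (flow x y) g) 0 0 = Real.exp x * mat g 0 0 ∧
      mat (act (flow x y) g) 0 1 = Real.exp y * mat g 0 1 ∧
      mat (act (flow x y) g) 1 0 = Real.exp (-y) * mat g 1 0 ∧
      mat (act (flow x y) g) 1 1 = Real.exp (-x) * mat g 1 1 := by
  have h := mat_act_gpow ((x + y) / 2) ((y - x) / 2) g
  rwa [show (x + y) / 2 - (y - x) / 2 = x by ring, show (x + y) / 2 + (y - x) / 2 = y by ring] at h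

theorem continuous_gpow : Continuous gpow := by
  refine Continuous.subtype_mk (continuous_matrix fun i j => ?_) _
  fin_cases i <;> fin_cases j <;> simp <;> fun_prop

theorem continuous_flow : Continuous fun v : ℝ × ℝ => flow v.1 v.2 := by
  refine .prodMk (continuous_gpow.comp ?_) (continuous_gpow.comp ?_) <;> fun_prop

theorem flow_zero : flow 0 0 = 1 := by
  simp [flow, gpow_zero]

theorem act_mul (z w : AdS3 × AdS3) (g : AdS3) : act (z * w) g = act z (act w g) := by
  simp [act, mul_assoc]

theorem act_one (g : AdS3) : act 1 g = g := by simp [act]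

theorem continuous_act (z : AdS3 × AdS3) : Continuous (act z) := by
  unfold act
  fun_prop

/-! ### The region of spacelike orbits -/

theorem hasDerivAt_act_gpow (p q : ℝ) (g : AdS3) :
    HasDerivAt (fun t : ℝ => mat (act (gpow (p * t), gpow (q * t)) g))
      ![![(p - q) * mat g 0 0, (p + q) * mat g 0 1],
        ![-(p + q) * mat g 1 0, -(p - q) * mat g 1 1]] 0 := by
  have key : ∀ r m : ℝ, HasDerivAt (fun t : ℝ => Real.exp (r * t) * m) (r * m) 0 := by
    intro r m
    have := (((hasDerivAt_id (0 : ℝ)).const_mul r).exp).mul_const m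
    simpa using this
  rw [hasDerivAt_pi]
  intro i
  rw [hasDerivAt_pi]
  intro j
  have h := fun t => mat_act_gpow (p * t) (q * t) g
  fin_cases i <;> fin_cases j
  · simpa [(h _).1, sub_mul] using key (p - q) (mat g 0 0)
  · simpa [(h _).2.1, add_mul] using key (p + q) (mat g 0 1)
  · have := key (-(p + q)) (mat g 1 0)
    simp only [neg_mul, add_mul] at this
    simpa [(h _).2.2.1, add_mul] using this
  · have := key (-(p - q)) (mat g 1 1)
    simp only [neg_mul, sub_mul] at this
    simpa [(h _).2.2.2, sub_mul] using this

/-- The metric on the orbit is diagonal in p - q and p + q, with coefficients ad and -bc; the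
directions (1, -1) and (1, 1) isolate the two coefficients. -/
theorem orbitIsSpacelike_iff (g : AdS3) :
    OrbitIsSpacelike g ↔ 0 < mat g 0 0 * mat g 1 1 ∧ mat g 0 1 * mat g 1 0 < 0 := by
  have hQ : ∀ p q : ℝ, Q (deriv (fun t : ℝ => mat (act (gpow (p * t), gpow (q * t)) g)) 0) =
      (p - q) ^ 2 * (mat g 0 0 * mat g 1 1) - (p + q) ^ 2 * (mat g 0 1 * mat g 1 0) := by
    intro p q
    rw [(hasDerivAt_act_gpow p q g).deriv, Q_eq]
    simp
    ring
  simp only [OrbitIsSpacelike, hQ]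
  constructor
  · intro h
    have h₁ := h 1 (-1) (by simp)
    have h₂ := h 1 1 (by simp)
    constructor <;> linarith
  · rintro ⟨h₁, h₂⟩ p q hpq
    by_cases h : p = q
    · subst h
      have hp : p ≠ 0 := by
        rintro rfl
        simp at hpq
      have : 0 < p ^ 2 := by positivity
      nlinarith
    · have h₃ : 0 < (p - q) ^ 2 := by
        have := sub_ne_zero.2 h
        positivity
      nlinarith [mul_pos h₃ h₁, mul_nonneg (sq_nonneg (p + q)) (neg_pos.2 h₂).le]

theorem mem_Omega_iff (g : AdS3) :
    g ∈ Omega ↔ 0 < mat g 0 0 * mat g 1 1 ∧ mat g 0 1 * mat g 1 0 < 0 := by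
  constructor
  · rintro ⟨h, hh, z, hz, rfl⟩
    obtain ⟨x, y, rfl⟩ := mem_A_iff.1 hz
    rw [orbitIsSpacelike_iff] at hh
    obtain ⟨h₁, h₂, h₃, h₄⟩ := mat_act_flow x y h
    have e₁ : Real.exp x * Real.exp (-x) = 1 := by rw [← Real.exp_add]; simp
    have e₂ : Real.exp y * Real.exp (-y) = 1 := by rw [← Real.exp_add]; simp
    rw [h₁, h₂, h₃, h₄, mul_mul_mul_comm, mul_mul_mul_comm (Real.exp y), e₁, e₂, one_mul, one_mul]
    exact hh
  · intro h
    exact ⟨g, (orbitIsSpacelike_iff g).2 h, 1, one_mem _, act_one g⟩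

/-! ### Sign quadrants of the region of spacelike orbits -/

/-- The part of `Omega` where the entries of the first row have the signs `s` and `r`. -/
def quadrant (s r : ℝ) : Set AdS3 :=
  {g | (0 < s * mat g 0 0 ∧ 0 < s * mat g 1 1) ∧ 0 < r * mat g 0 1 ∧ r * mat g 1 0 < 0}

section Quadrant

variable {s r : ℝ}

theorem isOpen_quadrant (s r : ℝ) : IsOpen (quadrant s r) := by
  have h : ∀ i j, Continuous fun g => mat g i j := fun i j =>
    (continuous_apply j).comp ((continuous_apply i).comp continuous_mat)
  have h₁ : ∀ (c : ℝ) i j, IsOpen {g | 0 < c * mat g i j} := fun c i j =>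
    isOpen_lt continuous_const (continuous_const.mul (h i j))
  have h₂ : ∀ (c : ℝ) i j, IsOpen {g | c * mat g i j < 0} := fun c i j =>
    isOpen_lt (continuous_const.mul (h i j)) continuous_const
  exact ((h₁ s 0 0).inter (h₁ s 1 1)).inter ((h₁ r 0 1).inter (h₂ r 1 0))

theorem mul_pos_of_mem (hs : s * s = 1) {g : AdS3} (hg : g ∈ quadrant s r) :
    0 < mat g 0 0 * mat g 1 1 := by
  have := mul_pos hg.1.1 hg.1.2
  rwa [mul_mul_mul_comm, hs, one_mul] at this

theorem mul_neg_of_mem (hr : r * r = 1) {g : AdS3} (hg : g ∈ quadrant s r) :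
    mat g 0 1 * mat g 1 0 < 0 := by
  have := mul_neg_of_pos_of_neg hg.2.1 hg.2.2
  rwa [mul_mul_mul_comm, hr, one_mul] at this

theorem entries_ne_zero {g : AdS3} (hg : g ∈ quadrant s r) :
    mat g 0 0 ≠ 0 ∧ mat g 0 1 ≠ 0 ∧ mat g 1 0 ≠ 0 ∧ mat g 1 1 ≠ 0 := by
  obtain ⟨⟨h₁, h₂⟩, h₃, h₄⟩ := hg
  exact ⟨right_ne_zero_of_mul h₁.ne', right_ne_zero_of_mul h₃.ne', right_ne_zero_of_mul h₄.ne,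
    right_ne_zero_of_mul h₂.ne'⟩

theorem quadrant_subset_Omega (hs : s * s = 1) (hr : r * r = 1) : quadrant s r ⊆ Omega :=
  fun g hg => (mem_Omega_iff g).2 ⟨mul_pos_of_mem hs hg, mul_neg_of_mem hr hg⟩

theorem exists_mem_quadrant {g : AdS3} (hg : g ∈ Omega) :
    ∃ s r : ℝ, s * s = 1 ∧ r * r = 1 ∧ g ∈ quadrant s r := by
  rw [mem_Omega_iff] at hg
  have key : ∀ x : ℝ, x ≠ 0 → ∃ s : ℝ, s * s = 1 ∧ 0 < s * x := by
    intro x hx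
    rcases hx.lt_or_gt with h | h
    · exact ⟨-1, by norm_num, by linarith⟩
    · exact ⟨1, by norm_num, by linarith⟩
  obtain ⟨s, hs, hs'⟩ := key _ (left_ne_zero_of_mul hg.1.ne')
  obtain ⟨r, hr, hr'⟩ := key _ (left_ne_zero_of_mul hg.2.ne)
  refine ⟨s, r, hs, hr, ⟨hs', ?_⟩, hr', ?_⟩
  · refine pos_of_mul_pos_right (a := s * mat g 0 0) ?_ hs'.le
    rw [mul_mul_mul_comm, hs, one_mul]
    exact hg.1
  · refine (pos_iff_neg_of_mul_neg (a := r * mat g 0 1) ?_).1 hr'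
    rw [mul_mul_mul_comm, hr, one_mul]
    exact hg.2

/-! ### Coordinates in which `A` acts by translations -/

/-- The coordinate along which the orbits of `A` are the level sets, with `σ` the sign of the
product of the entries of the first row. -/
def coordT (σ : ℝ) (X : Mat) : ℝ :=
  σ / 2 * (Real.log (X 0 1) + Real.log (X 1 0) - Real.log (X 0 0) - Real.log (X 1 1))

/-- The coordinate translated by the first parameter of `flow`. -/
def coordX (X : Mat) : ℝ := (Real.log (X 0 0) - Real.log (X 1 1)) / 2

/-- The coordinate translated by the second parameter of `flow`. -/
def coordY (X : Mat) : ℝ := (Real.log (X 0 1) - Real.log (X 1 0)) / 2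

/-- The common factor of the entries of `param`. -/
def radius (σ k : ℝ) : ℝ := (√(1 + Real.exp (2 * (σ * k))))⁻¹

theorem radius_pos (σ k : ℝ) : 0 < radius σ k := by
  unfold radius
  positivity

theorem radius_sq (σ k : ℝ) :
    radius σ k * radius σ k * (1 + Real.exp (σ * k) * Real.exp (σ * k)) = 1 := by
  have h : 0 < 1 + Real.exp (2 * (σ * k)) := by positivity
  rw [radius, ← mul_inv, Real.mul_self_sqrt h.le, ← Real.exp_add, ← two_mul,
    inv_mul_cancel₀ h.ne']

/-- The point of `quadrant s r` with given coordinates. -/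
def param (s r : ℝ) (hs : s * s = 1) (hr : r * r = 1) (k x y : ℝ) : AdS3 :=
  ⟨!![s * (radius (s * r) k * Real.exp x),
      r * (radius (s * r) k * Real.exp (s * r * k) * Real.exp y);
      -(r * (radius (s * r) k * Real.exp (s * r * k) * Real.exp (-y))),
      s * (radius (s * r) k * Real.exp (-x))], by
    rw [Matrix.det_fin_two_of]
    have e₁ : Real.exp x * Real.exp (-x) = 1 := by rw [← Real.exp_add]; simp
    have e₂ : Real.exp y * Real.exp (-y) = 1 := by rw [← Real.exp_add]; simp
    have h := radius_sq (s * r) k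
    generalize radius (s * r) k = ρ at *
    generalize Real.exp (s * r * k) = E at *
    calc _ = s * s * (ρ * ρ) * (Real.exp x * Real.exp (-x)) +
          r * r * (ρ * ρ * (E * E)) * (Real.exp y * Real.exp (-y)) := by ring
      _ = 1 := by rw [hs, hr, e₁, e₂]; linarith⟩

theorem mat_param (hs : s * s = 1) (hr : r * r = 1) (k x y : ℝ) :
    mat (param s r hs hr k x y) 0 0 = s * (radius (s * r) k * Real.exp x) ∧
      mat (param s r hs hr k x y) 0 1 =
        r * (radius (s * r) k * Real.exp (s * r * k) * Real.exp y) ∧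
      mat (param s r hs hr k x y) 1 0 =
        -(r * (radius (s * r) k * Real.exp (s * r * k) * Real.exp (-y))) ∧
      mat (param s r hs hr k x y) 1 1 = s * (radius (s * r) k * Real.exp (-x)) :=
  ⟨rfl, rfl, rfl, rfl⟩

theorem param_mem (hs : s * s = 1) (hr : r * r = 1) (k x y : ℝ) :
    param s r hs hr k x y ∈ quadrant s r := by
  obtain ⟨h₁, h₂, h₃, h₄⟩ := mat_param hs hr k x y
  have := radius_pos (s * r) k
  simp only [quadrant, Set.mem_ofPred_eq, h₁, h₂, h₃, h₄, mul_neg, ← mul_assoc, hs, hr, one_mul]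
  refine ⟨⟨?_, ?_⟩, ?_, neg_lt_zero.2 ?_⟩ <;> positivity

/-- `Real.log x` is log |x|, so the coordinates need no signs and one set of formulas serves all
quadrants. -/
theorem log_sign_mul (hs : s * s = 1) (x : ℝ) : Real.log (s * x) = Real.log x := by
  rcases mul_self_eq_one_iff.1 hs with rfl | rfl <;> simp

theorem coords_param (hs : s * s = 1) (hr : r * r = 1) (k x y : ℝ) :
    coordT (s * r) (mat (param s r hs hr k x y)) = k ∧
      coordX (mat (param s r hs hr k x y)) = x ∧ coordY (mat (param s r hs hr k x y)) = y := by
  obtain ⟨h₁, h₂, h₃, h₄⟩ := mat_param hs hr k x y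
  have hρ := (radius_pos (s * r) k).ne'
  have hE : ∀ x, Real.exp x ≠ 0 := Real.exp_ne_zero
  have hsr : s * r * (s * r) = 1 := by rw [mul_mul_mul_comm, hs, hr, one_mul]
  simp only [coordT, coordX, coordY, h₁, h₂, h₃, h₄, Real.log_neg_eq_log, log_sign_mul hs,
    log_sign_mul hr]
  simp only [Real.log_mul (mul_ne_zero hρ (hE _)) (hE _), Real.log_mul hρ (hE _), Real.log_exp]
  refine ⟨?_, by ring, by ring⟩
  linear_combination k * hsr

theorem mul_exp_log (hs : s * s = 1) {x : ℝ} (hx : 0 < s * x) : s * Real.exp (Real.log x) = x := by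
  rw [← log_sign_mul hs, Real.exp_log hx, ← mul_assoc, hs, one_mul]

/-- This is D = e^{2σT} P. Together with P + D = 1 it recovers P and D from T. -/
theorem exp_coordT (hs : s * s = 1) (hr : r * r = 1) {g : AdS3} (hg : g ∈ quadrant s r) :
    mat g 0 0 * mat g 1 1 * (Real.exp (s * r * coordT (s * r) (mat g)) *
      Real.exp (s * r * coordT (s * r) (mat g))) = -(mat g 0 1 * mat g 1 0) := by
  obtain ⟨h₁, h₂, h₃, h₄⟩ := entries_ne_zero hg
  have hsr : s * r * (s * r) = 1 := by rw [mul_mul_mul_comm, hs, hr, one_mul]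
  have h : s * r * coordT (s * r) (mat g) + s * r * coordT (s * r) (mat g) =
      Real.log (-(mat g 0 1 * mat g 1 0)) - Real.log (mat g 0 0 * mat g 1 1) := by
    rw [Real.log_neg_eq_log, Real.log_mul h₂ h₃, Real.log_mul h₁ h₄, coordT]
    linear_combination (Real.log (mat g 0 1) + Real.log (mat g 1 0) - Real.log (mat g 0 0) -
      Real.log (mat g 1 1)) * hsr
  have hP := mul_pos_of_mem hs hg
  rw [← Real.exp_add, h, Real.exp_sub, Real.exp_log hP,
    Real.exp_log (neg_pos.2 (mul_neg_of_mem hr hg)), mul_div_cancel₀ _ hP.ne']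

/-- Both sides are positive with square P = 1 / (1 + e^{2σT}). -/
theorem radius_coordT (hs : s * s = 1) (hr : r * r = 1) {g : AdS3} (hg : g ∈ quadrant s r) :
    radius (s * r) (coordT (s * r) (mat g)) =
      Real.exp ((Real.log (mat g 0 0) + Real.log (mat g 1 1)) / 2) := by
  have h := exp_coordT hs hr hg
  have hP := mul_pos_of_mem hs hg
  have hd := mat_det g
  obtain ⟨h₁, h₂, h₃, h₄⟩ := entries_ne_zero hg
  have h' := radius_sq (s * r) (coordT (s * r) (mat g))
  rw [← mul_self_inj_of_nonneg (radius_pos _ _).le (Real.exp_pos _).le, ← Real.exp_add,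
    add_halves, ← Real.log_mul h₁ h₄, Real.exp_log hP]
  generalize Real.exp (s * r * coordT (s * r) (mat g)) = E at *
  have e : mat g 0 0 * mat g 1 1 * (1 + E * E) = 1 := by linarith
  have hE : 1 + E * E ≠ 0 := by nlinarith [mul_self_nonneg E]
  exact mul_right_cancel₀ hE (h'.trans e.symm)

theorem param_coords (hs : s * s = 1) (hr : r * r = 1) {g : AdS3} (hg : g ∈ quadrant s r) :
    param s r hs hr (coordT (s * r) (mat g)) (coordX (mat g)) (coordY (mat g)) = g := by
  have hsr : s * r * (s * r) = 1 := by rw [mul_mul_mul_comm, hs, hr, one_mul]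
  have hT : s * r * coordT (s * r) (mat g) = (Real.log (mat g 0 1) + Real.log (mat g 1 0) -
      Real.log (mat g 0 0) - Real.log (mat g 1 1)) / 2 := by
    rw [coordT]
    linear_combination (Real.log (mat g 0 1) + Real.log (mat g 1 0) - Real.log (mat g 0 0) -
      Real.log (mat g 1 1)) / 2 * hsr
  apply mat_injective
  obtain ⟨h₁, h₂, h₃, h₄⟩ :=
    mat_param hs hr (coordT (s * r) (mat g)) (coordX (mat g)) (coordY (mat g))
  rw [radius_coordT hs hr hg, ← Real.exp_add] at h₁ h₂ h₃ h₄
  rw [hT, ← Real.exp_add] at h₂ h₃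
  have hc : 0 < -r * mat g 1 0 := by linarith [hg.2.2]
  apply mat_ext
  · rw [h₁, coordX]
    refine Eq.trans ?_ (mul_exp_log hs hg.1.1)
    congr 2
    ring
  · rw [h₂, coordY]
    refine Eq.trans ?_ (mul_exp_log hr hg.2.1)
    congr 2
    ring
  · rw [h₃, coordY, ← neg_mul]
    refine Eq.trans ?_ (mul_exp_log (s := -r) (by linarith) hc)
    congr 2
    ring
  · rw [h₄, coordX]
    refine Eq.trans ?_ (mul_exp_log hs hg.1.2)
    congr 2
    ring

theorem continuous_param (hs : s * s = 1) (hr : r * r = 1) :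
    Continuous fun v : ℝ × ℝ × ℝ => param s r hs hr v.1 v.2.1 v.2.2 := by
  have hρ : Continuous fun v : ℝ × ℝ × ℝ => radius (s * r) v.1 := by
    unfold radius
    refine Continuous.inv₀ (by fun_prop) fun v => ?_
    positivity
  refine Continuous.subtype_mk (continuous_matrix fun i j => ?_) _
  fin_cases i <;> fin_cases j <;> simp <;> fun_prop

theorem continuousOn_coords (σ s r : ℝ) :
    ContinuousOn (fun g => coordT σ (mat g)) (quadrant s r) ∧
      ContinuousOn (fun g => coordX (mat g)) (quadrant s r) ∧
      ContinuousOn (fun g => coordY (mat g)) (quadrant s r) := by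
  have h : ∀ i j, Continuous fun g => mat g i j := fun i j =>
    (continuous_apply j).comp ((continuous_apply i).comp continuous_mat)
  have h₁ : ContinuousOn (fun g => Real.log (mat g 0 0)) (quadrant s r) :=
    (h 0 0).continuousOn.log fun g hg => (entries_ne_zero hg).1
  have h₂ : ContinuousOn (fun g => Real.log (mat g 0 1)) (quadrant s r) :=
    (h 0 1).continuousOn.log fun g hg => (entries_ne_zero hg).2.1
  have h₃ : ContinuousOn (fun g => Real.log (mat g 1 0)) (quadrant s r) :=
    (h 1 0).continuousOn.log fun g hg => (entries_ne_zero hg).2.2.1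
  have h₄ : ContinuousOn (fun g => Real.log (mat g 1 1)) (quadrant s r) :=
    (h 1 1).continuousOn.log fun g hg => (entries_ne_zero hg).2.2.2
  exact ⟨continuousOn_const.mul (((h₂.add h₃).sub h₁).sub h₄), (h₁.sub h₄).div_const 2,
    (h₂.sub h₃).div_const 2⟩

theorem eq_of_coords_eq (hs : s * s = 1) (hr : r * r = 1) {g h : AdS3} (hg : g ∈ quadrant s r)
    (hh : h ∈ quadrant s r) (hT : coordT (s * r) (mat g) = coordT (s * r) (mat h))
    (hX : coordX (mat g) = coordX (mat h)) (hY : coordY (mat g) = coordY (mat h)) : g = h := by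
  rw [← param_coords hs hr hg, hT, hX, hY, param_coords hs hr hh]

theorem act_flow_mem {g : AdS3} (hg : g ∈ quadrant s r) (x y : ℝ) :
    act (flow x y) g ∈ quadrant s r := by
  obtain ⟨h₁, h₂, h₃, h₄⟩ := mat_act_flow x y g
  simp only [quadrant, Set.mem_ofPred_eq, h₁, h₂, h₃, h₄, mul_left_comm _ (Real.exp _)]
  exact ⟨⟨mul_pos (Real.exp_pos _) hg.1.1, mul_pos (Real.exp_pos _) hg.1.2⟩,
    mul_pos (Real.exp_pos _) hg.2.1, mul_neg_of_pos_of_neg (Real.exp_pos _) hg.2.2⟩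

theorem coords_act_flow (σ : ℝ) {g : AdS3} (hg : g ∈ quadrant s r) (x y : ℝ) :
    coordT σ (mat (act (flow x y) g)) = coordT σ (mat g) ∧
      coordX (mat (act (flow x y) g)) = x + coordX (mat g) ∧
      coordY (mat (act (flow x y) g)) = y + coordY (mat g) := by
  obtain ⟨h₁, h₂, h₃, h₄⟩ := mat_act_flow x y g
  obtain ⟨n₁, n₂, n₃, n₄⟩ := entries_ne_zero hg
  have hE : ∀ x, Real.exp x ≠ 0 := Real.exp_ne_zero
  simp only [coordT, coordX, coordY, h₁, h₂, h₃, h₄, Real.log_mul (hE _) n₁,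
    Real.log_mul (hE _) n₂, Real.log_mul (hE _) n₃, Real.log_mul (hE _) n₄, Real.log_exp]
  refine ⟨?_, ?_, ?_⟩ <;> ring

theorem act_mem_of_mem_A {z : AdS3 × AdS3} (hz : z ∈ A) {g : AdS3} (hg : g ∈ quadrant s r) :
    act z g ∈ quadrant s r := by
  obtain ⟨x, y, rfl⟩ := mem_A_iff.1 hz
  exact act_flow_mem hg x y

/-- Points of a quadrant with equal first coordinates differ by an element of `A`. -/
theorem act_flow_eq (hs : s * s = 1) (hr : r * r = 1) {g h : AdS3} (hg : g ∈ quadrant s r)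
    (hh : h ∈ quadrant s r) (hT : coordT (s * r) (mat g) = coordT (s * r) (mat h)) :
    act (flow (coordX (mat h) - coordX (mat g)) (coordY (mat h) - coordY (mat g))) g = h := by
  obtain ⟨h₁, h₂, h₃⟩ := coords_act_flow (s * r) hg (coordX (mat h) - coordX (mat g))
    (coordY (mat h) - coordY (mat g))
  exact eq_of_coords_eq hs hr (act_flow_mem hg _ _) hh (h₁.trans hT) (by rw [h₂]; ring)
    (by rw [h₃]; ring)

theorem orbitA_subset {g : AdS3} (hg : g ∈ quadrant s r) : orbitA g ⊆ quadrant s r := by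
  rintro _ ⟨z, hz, rfl⟩
  exact act_mem_of_mem_A hz hg

theorem mem_orbitA_iff (hs : s * s = 1) (hr : r * r = 1) {g h : AdS3} (hg : g ∈ quadrant s r)
    (hh : h ∈ quadrant s r) :
    h ∈ orbitA g ↔ coordT (s * r) (mat h) = coordT (s * r) (mat g) := by
  constructor
  · rintro ⟨z, hz, rfl⟩
    obtain ⟨x, y, rfl⟩ := mem_A_iff.1 hz
    exact (coords_act_flow _ hg x y).1
  · intro h'
    exact ⟨_, flow_mem_A _ _, act_flow_eq hs hr hg hh h'.symm⟩

/-! ### The components of `Omega` -/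

theorem isConnected_quadrant (hs : s * s = 1) (hr : r * r = 1) : IsConnected (quadrant s r) := by
  have h : quadrant s r = Set.range fun v : ℝ × ℝ × ℝ => param s r hs hr v.1 v.2.1 v.2.2 := by
    ext g
    constructor
    · intro hg
      exact ⟨(_, _, _), param_coords hs hr hg⟩
    · rintro ⟨v, rfl⟩
      exact param_mem hs hr _ _ _
  rw [h]
  exact isConnected_range (continuous_param hs hr)

/-- The quadrant is a continuous image of ℝ³, hence connected. In `Omega` the signs of the first row
determine those of the second, so the rest of `Omega` lies in the open set where one sign of the
first row is flipped. -/
theorem connectedComponentIn_Omega (hs : s * s = 1) (hr : r * r = 1) {g : AdS3}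
    (hg : g ∈ quadrant s r) : connectedComponentIn Omega g = quadrant s r := by
  have hΩ := quadrant_subset_Omega hs hr
  refine Set.Subset.antisymm ?_
    ((isConnected_quadrant hs hr).isPreconnected.subset_connectedComponentIn hg hΩ)
  have h : ∀ i j, Continuous fun g => mat g i j := fun i j =>
    (continuous_apply j).comp ((continuous_apply i).comp continuous_mat)
  have hV : IsOpen {g | s * mat g 0 0 < 0 ∨ r * mat g 0 1 < 0} :=
    (isOpen_lt (continuous_const.mul (h 0 0)) continuous_const).union
      (isOpen_lt (continuous_const.mul (h 0 1)) continuous_const)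
  refine isPreconnected_connectedComponentIn.subset_left_of_subset_union (isOpen_quadrant s r) hV
    ?_ ?_ ⟨g, mem_connectedComponentIn (hΩ hg), hg⟩
  · rw [Set.disjoint_left]
    rintro x hx (h' | h')
    · exact lt_asymm h' hx.1.1
    · exact lt_asymm h' hx.2.1
  · intro x hx
    have hx' := (mem_Omega_iff x).1 (connectedComponentIn_subset _ _ hx)
    have key : ∀ {t : ℝ}, t * t = 1 → ∀ {y : ℝ}, y ≠ 0 → ¬ t * y < 0 → 0 < t * y := by
      intro t ht y hy h'
      refine lt_of_le_of_ne (not_lt.1 h') (mul_ne_zero ?_ hy).symm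
      rintro rfl
      simp at ht
    by_cases h₁ : s * mat x 0 0 < 0
    · exact Or.inr (Or.inl h₁)
    by_cases h₂ : r * mat x 0 1 < 0
    · exact Or.inr (Or.inr h₂)
    have h₁' := key hs (left_ne_zero_of_mul hx'.1.ne') h₁
    have h₂' := key hr (left_ne_zero_of_mul hx'.2.ne) h₂
    refine Or.inl ⟨⟨h₁', ?_⟩, h₂', ?_⟩
    · refine pos_of_mul_pos_right (a := s * mat x 0 0) ?_ h₁'.le
      rw [mul_mul_mul_comm, hs, one_mul]
      exact hx'.1
    · refine (pos_iff_neg_of_mul_neg (a := r * mat x 0 1) ?_).1 h₂'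
      rw [mul_mul_mul_comm, hr, one_mul]
      exact hx'.2

theorem eq_quadrant_of_isComponentOfOmega {U : Set AdS3} (hU : IsComponentOfOmega U) :
    ∃ s r : ℝ, s * s = 1 ∧ r * r = 1 ∧ U = quadrant s r := by
  obtain ⟨g, hg, rfl⟩ := hU
  obtain ⟨s, r, hs, hr, h⟩ := exists_mem_quadrant hg
  exact ⟨s, r, hs, hr, connectedComponentIn_Omega hs hr h⟩

/-! ### Rotations -/

theorem mat_rot (θ : ℝ) : mat (rot θ) 0 0 = Real.cos θ ∧ mat (rot θ) 0 1 = Real.sin θ ∧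
    mat (rot θ) 1 0 = -Real.sin θ ∧ mat (rot θ) 1 1 = Real.cos θ :=
  ⟨rfl, rfl, rfl, rfl⟩

theorem rot_mem_iff {θ : ℝ} :
    rot θ ∈ quadrant s r ↔ 0 < s * Real.cos θ ∧ 0 < r * Real.sin θ := by
  obtain ⟨h₁, h₂, h₃, h₄⟩ := mat_rot θ
  simp only [quadrant, Set.mem_ofPred_eq, h₁, h₂, h₃, h₄, mul_neg, neg_lt_zero, and_self]

/-- The slope `tan θ` of a rotation in terms of its first coordinate. -/
theorem tan_eq_of_rot_mem (hs : s * s = 1) (hr : r * r = 1) {θ : ℝ} (h : rot θ ∈ quadrant s r) :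
    Real.tan θ = s * r * Real.exp (s * r * coordT (s * r) (mat (rot θ))) := by
  have hE := exp_coordT hs hr h
  obtain ⟨h₁, h₂, h₃, h₄⟩ := mat_rot θ
  rw [h₁, h₂, h₃, h₄] at hE
  rw [rot_mem_iff] at h
  have hE' := Real.exp_pos (s * r * coordT (s * r) (mat (rot θ)))
  generalize Real.exp (s * r * coordT (s * r) (mat (rot θ))) = E at hE hE' ⊢
  -- Both sides are positive, so it suffices to compare squares.
  have key : r * Real.sin θ = s * Real.cos θ * E := by
    rw [← mul_self_inj_of_nonneg h.2.le (mul_pos h.1 hE').le]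
    linear_combination Real.sin θ ^ 2 * hr - Real.cos θ ^ 2 * E ^ 2 * hs - hE
  rw [Real.tan_eq_sin_div_cos, div_eq_iff (right_ne_zero_of_mul h.1.ne')]
  linear_combination r * key - Real.sin θ * hr

theorem sinh_eq_of_sign {σ : ℝ} (hσ : σ * σ = 1) (k : ℝ) :
    σ * Real.exp (σ * k) - (σ * Real.exp (σ * k))⁻¹ = 2 * Real.sinh k := by
  rw [Real.sinh_eq, mul_inv, ← Real.exp_neg]
  rcases mul_self_eq_one_iff.1 hσ with rfl | rfl
  · simp
    ring
  · norm_num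
    ring

theorem sign_mul_sign (hs : s * s = 1) (hr : r * r = 1) : s * r * (s * r) = 1 := by
  rw [mul_mul_mul_comm, hs, hr, one_mul]

/-- Since -2 cot 2θ = tan θ - cot θ and tan θ = σe^{σT}, the two exponentials combine into a
hyperbolic sine for either sign σ. -/
theorem neg_two_cot_eq (hs : s * s = 1) (hr : r * r = 1) {θ : ℝ} (h : rot θ ∈ quadrant s r) :
    -2 * Real.cot (2 * θ) = 2 * Real.sinh (coordT (s * r) (mat (rot θ))) := by
  rw [← sinh_eq_of_sign (sign_mul_sign hs hr), ← tan_eq_of_rot_mem hs hr h]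
  rw [rot_mem_iff] at h
  have hc := right_ne_zero_of_mul h.1.ne'
  have hs' := right_ne_zero_of_mul h.2.ne'
  rw [Real.cot_eq_cos_div_sin, Real.sin_two_mul, Real.cos_two_mul', Real.tan_eq_sin_div_cos]
  field_simp
  ring

theorem existsUnique_rot_eq {g : AdS3} (h₁ : mat g 1 1 = mat g 0 0)
    (h₂ : mat g 1 0 = -mat g 0 1) : ∃! θ : ℝ, θ ∈ Set.Ico 0 (2 * Real.pi) ∧ rot θ = g := by
  have hd := mat_det g
  rw [h₁, h₂] at hd
  have hrot : ∀ θ, rot θ = g ↔ Real.cos θ = mat g 0 0 ∧ Real.sin θ = mat g 0 1 := by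
    intro θ
    obtain ⟨e₁, e₂, e₃, e₄⟩ := mat_rot θ
    constructor
    · rintro rfl
      exact ⟨e₁.symm, e₂.symm⟩
    · rintro ⟨hc, hs⟩
      apply mat_injective
      apply mat_ext
      · rw [e₁, hc]
      · rw [e₂, hs]
      · rw [e₃, hs, h₂]
      · rw [e₄, hc, h₁]
  have hpi : (0 : ℝ) < 2 * Real.pi := by positivity
  obtain ⟨φ, hφ⟩ : ∃ φ, rot φ = g := by
    set z : ℂ := ⟨mat g 0 0, mat g 0 1⟩ with hz
    have hn : ‖z‖ = 1 := by
      rw [Complex.norm_def, Complex.normSq_mk, Real.sqrt_eq_one]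
      linarith
    have hz0 : z ≠ 0 := by
      rw [← norm_ne_zero_iff, hn]
      exact one_ne_zero
    refine ⟨z.arg, (hrot _).2 ⟨?_, ?_⟩⟩
    · rw [Complex.cos_arg hz0, hn, div_one]
    · rw [Complex.sin_arg, hn, div_one]
  refine ⟨toIcoMod hpi 0 φ, ⟨by simpa using toIcoMod_mem_Ico hpi 0 φ, ?_⟩, ?_⟩
  · rw [hrot] at hφ ⊢
    rw [toIcoMod, zsmul_eq_mul, Real.cos_sub_int_mul_two_pi, Real.sin_sub_int_mul_two_pi]
    exact hφ
  · rintro θ ⟨hθ, hθ'⟩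
    rw [hrot] at hφ hθ'
    have := Real.Angle.cos_sin_inj (hθ'.1.trans hφ.1.symm) (hθ'.2.trans hφ.2.symm)
    rw [Real.Angle.angle_eq_iff_two_pi_dvd_sub] at this
    obtain ⟨n, hn⟩ := this
    rw [show φ = θ - n • (2 * Real.pi) by rw [zsmul_eq_mul]; linarith, toIcoMod_sub_zsmul, eq_comm,
      toIcoMod_eq_self]
    simpa using hθ

/-- The rotations in a quadrant form its line X = Y = 0, which each level of T meets in the single
point `param _ _ _ _ k 0 0`. -/
theorem existsUnique_rot_mem_orbitA (hs : s * s = 1) (hr : r * r = 1) {g : AdS3}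
    (hg : g ∈ quadrant s r) :
    ∃! θ : ℝ, θ ∈ Set.Ico 0 (2 * Real.pi) ∧ rot θ ∈ orbitA g := by
  obtain ⟨h₁, h₂, h₃, h₄⟩ := mat_param hs hr (coordT (s * r) (mat g)) 0 0
  have hp := param_mem hs hr (coordT (s * r) (mat g)) 0 0
  obtain ⟨c₁, c₂, c₃⟩ := coords_param hs hr (coordT (s * r) (mat g)) 0 0
  have hiff : ∀ θ, rot θ ∈ orbitA g ↔ rot θ = param s r hs hr (coordT (s * r) (mat g)) 0 0 := by
    intro θ
    constructor
    · intro h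
      have hm := orbitA_subset hg h
      rw [mem_orbitA_iff hs hr hg hm] at h
      obtain ⟨e₁, e₂, e₃, e₄⟩ := mat_rot θ
      refine eq_of_coords_eq hs hr hm hp (h.trans c₁.symm) (.trans ?_ c₂.symm)
        (.trans ?_ c₃.symm)
      · simp [coordX, e₁, e₄]
      · simp [coordY, e₂, e₃]
    · intro h
      rw [h, mem_orbitA_iff hs hr hg hp, c₁]
  simp only [hiff]
  exact existsUnique_rot_eq (by rw [h₁, h₄, neg_zero]) (by rw [h₂, h₃, neg_zero])

end Quadrant

/-! ### The quotient of a quadrant by a lattice -/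

section Lattice

variable {s r : ℝ} {Γ : Subgroup (AdS3 × AdS3)}

/-- Freeness of the action: a translation is determined by its effect on one point. -/
theorem eq_flow_of_act_eq {z : AdS3 × AdS3} (hz : z ∈ A) {g h : AdS3} (hg : g ∈ quadrant s r)
    (hzg : act z g = h) :
    z = flow (coordX (mat h) - coordX (mat g)) (coordY (mat h) - coordY (mat g)) := by
  obtain ⟨x, y, rfl⟩ := mem_A_iff.1 hz
  obtain ⟨-, h₂, h₃⟩ := coords_act_flow 1 hg x y
  rw [← hzg, h₂, h₃, add_sub_cancel_right, add_sub_cancel_right]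

theorem eventually_eq_of_mem {G : Type*} [Group G] [TopologicalSpace G] {Γ : Subgroup G}
    (hd : DiscreteTopology Γ) {z : G} (hz : z ∈ Γ) : ∀ᶠ w in 𝓝 z, w ∈ Γ → w = z := by
  have h : {(⟨z, hz⟩ : Γ)} ∈ 𝓝 (⟨z, hz⟩ : Γ) := by simp [nhds_discrete]
  rw [nhds_subtype_eq_comap, Filter.mem_comap] at h
  obtain ⟨V, hV, h⟩ := h
  filter_upwards [hV] with w hw hw'
  exact congrArg Subtype.val (h (show (⟨w, hw'⟩ : Γ) ∈ Subtype.val ⁻¹' V from hw))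

/-- Two continuous lifts to a quadrant of the same map to the quotient by a discrete subgroup of
`A` locally differ by a fixed element of the subgroup. -/
theorem eventually_act_eq (hΓ : Γ ≤ A) (hd : DiscreteTopology Γ) {T : Type*} [TopologicalSpace T]
    {u v : T → AdS3} {t₀ : T} (hu : ContinuousAt u t₀) (hv : ContinuousAt v t₀)
    (hu₀ : u t₀ ∈ quadrant s r) (h : ∀ᶠ t in 𝓝 t₀, ∃ z ∈ Γ, act z (u t) = v t) :
    ∃ z ∈ Γ, ∀ᶠ t in 𝓝 t₀, act z (u t) = v t := by
  have hu' : ∀ᶠ t in 𝓝 t₀, u t ∈ quadrant s r := hu ((isOpen_quadrant s r).mem_nhds hu₀)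
  obtain ⟨z₀, hz₀, h₀⟩ := h.self_of_nhds
  have hv₀ : v t₀ ∈ quadrant s r := h₀ ▸ act_mem_of_mem_A (hΓ hz₀) hu₀
  have hX : ContinuousAt (fun g => coordX (mat g)) (u t₀) :=
    (continuousOn_coords 1 s r).2.1.continuousAt ((isOpen_quadrant s r).mem_nhds hu₀)
  have hY : ContinuousAt (fun g => coordY (mat g)) (u t₀) :=
    (continuousOn_coords 1 s r).2.2.continuousAt ((isOpen_quadrant s r).mem_nhds hu₀)
  have hX' : ContinuousAt (fun g => coordX (mat g)) (v t₀) :=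
    (continuousOn_coords 1 s r).2.1.continuousAt ((isOpen_quadrant s r).mem_nhds hv₀)
  have hY' : ContinuousAt (fun g => coordY (mat g)) (v t₀) :=
    (continuousOn_coords 1 s r).2.2.continuousAt ((isOpen_quadrant s r).mem_nhds hv₀)
  -- The element relating the lifts depends continuously on the parameter; taking values in a
  -- discrete subgroup, it is locally constant.
  have hc : ContinuousAt (fun t => flow (coordX (mat (v t)) - coordX (mat (u t)))
      (coordY (mat (v t)) - coordY (mat (u t)))) t₀ :=
    continuous_flow.continuousAt.comp (f := fun t => (coordX (mat (v t)) - coordX (mat (u t)),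
      coordY (mat (v t)) - coordY (mat (u t))))
      (((hX'.comp hv).sub (hX.comp hu)).prodMk ((hY'.comp hv).sub (hY.comp hu)))
  refine ⟨z₀, hz₀, ?_⟩
  have hev := eventually_eq_of_mem hd hz₀
  rw [eq_flow_of_act_eq (hΓ hz₀) hu₀ h₀] at hev
  filter_upwards [h, hu', hc.eventually hev] with t ht hut hzt
  obtain ⟨z, hz, hzt'⟩ := ht
  have := eq_flow_of_act_eq (hΓ hz) hut hzt'
  rw [eq_flow_of_act_eq (hΓ hz₀) hu₀ h₀, ← hzt (this ▸ hz), ← this, hzt']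

/-- The element of `A` relating the second and third coordinates of two points is continuous. -/
theorem continuous_shift (s r : ℝ) : Continuous fun p : quadrant s r × quadrant s r =>
    flow (coordX (mat p.2.1) - coordX (mat p.1.1)) (coordY (mat p.2.1) - coordY (mat p.1.1)) := by
  have hX : Continuous fun u : quadrant s r => coordX (mat u.1) :=
    continuousOn_iff_continuous_domRestrict.1 (continuousOn_coords 1 s r).2.1
  have hY : Continuous fun u : quadrant s r => coordY (mat u.1) :=
    continuousOn_iff_continuous_domRestrict.1 (continuousOn_coords 1 s r).2.2
  exact continuous_flow.comp (((hX.comp continuous_snd).sub (hX.comp continuous_fst)).prodMk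
    ((hY.comp continuous_snd).sub (hY.comp continuous_fst)))

/-- The action of a subgroup of `A` on a quadrant. -/
@[reducible] def quadrantAction (hΓ : Γ ≤ A) : MulAction Γ (quadrant s r) where
  smul z u := ⟨act z.1 u.1, act_mem_of_mem_A (hΓ z.2) u.2⟩
  one_smul u := Subtype.ext (act_one u.1)
  mul_smul z w u := Subtype.ext (act_mul z.1 w.1 u.1)

theorem proj_eq_iff {u v : quadrant s r} :
    proj Γ (quadrant s r) u = proj Γ (quadrant s r) v ↔ ∃ z ∈ Γ, act z u.1 = v.1 := by
  unfold proj
  rw [Quotient.eq]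
  rfl

/-- An element of `Γ` sending a point of a small neighbourhood of `u` into that neighbourhood is the
shift between two nearby points. It is then close to 1, hence equal to 1 by discreteness. -/
theorem isQuotientCoveringMap_proj (hΓ : Γ ≤ A) (hd : DiscreteTopology Γ) :
    letI := quadrantAction (s := s) (r := r) hΓ
    IsQuotientCoveringMap (proj Γ (quadrant s r)) Γ := by
  let := quadrantAction (s := s) (r := r) hΓ
  have hquot : IsQuotientMap (proj Γ (quadrant s r)) := isQuotientMap_quot_mk
  refine { hquot with
    continuous_const_smul := fun z =>
      ((continuous_act z.1).comp continuous_subtype_val).subtype_mk _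
    apply_eq_iff_mem_orbit := ?_
    disjoint := ?_ }
  · intro u v
    rw [eq_comm, proj_eq_iff]
    constructor
    · rintro ⟨z, hz, h⟩
      exact ⟨⟨z, hz⟩, Subtype.ext h⟩
    · rintro ⟨z, h⟩
      exact ⟨z.1, z.2, congrArg Subtype.val h⟩
  · intro u
    have hc := continuous_shift s r
    have hev := eventually_eq_of_mem hd Γ.one_mem
    rw [← flow_zero] at hev
    have hcu := hc.tendsto (u, u)
    simp only [sub_self] at hcu
    have := hcu.eventually hev
    rw [nhds_prod_eq, Filter.eventually_prod_self_iff'] at this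
    obtain ⟨N, hN, hN'⟩ := this
    refine ⟨N, hN, ?_⟩
    rintro z ⟨_, ⟨v, hv, rfl⟩, hw⟩
    have hz := eq_flow_of_act_eq (hΓ z.2) v.2 rfl
    have h₁ := hN' v hv _ hw (by erw [← hz]; exact z.2)
    exact Subtype.ext ((hz.trans h₁).trans flow_zero)

/-- The first coordinate as a function on the quotient. -/
def quotientCoordT (hΓ : Γ ≤ A) : TorusUniverse Γ (quadrant s r) → ℝ :=
  Quotient.lift (fun u => coordT (s * r) (mat u.1)) (by
    rintro u v ⟨z, hz, h⟩
    obtain ⟨x, y, rfl⟩ := mem_A_iff.1 (hΓ hz)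
    rw [← h]
    exact (coords_act_flow _ u.2 x y).1.symm)

theorem quotientCoordT_proj (hΓ : Γ ≤ A) (u : quadrant s r) :
    quotientCoordT hΓ (proj Γ (quadrant s r) u) = coordT (s * r) (mat u.1) := rfl

theorem continuous_quotientCoordT (hΓ : Γ ≤ A) :
    Continuous (quotientCoordT (s := s) (r := r) hΓ) :=
  (continuousOn_iff_continuous_domRestrict.1 (continuousOn_coords (s * r) s r).1).quotient_lift _

theorem orbitImage_eq (hs : s * s = 1) (hr : r * r = 1) (hΓ : Γ ≤ A) {g : AdS3}
    (hg : g ∈ quadrant s r) :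
    orbitImage Γ (quadrant s r) g = {q | quotientCoordT hΓ q = coordT (s * r) (mat g)} := by
  ext q
  obtain ⟨u, rfl⟩ := Quotient.exists_rep q
  constructor
  · rintro ⟨v, hv, h⟩
    rw [← h]
    exact (mem_orbitA_iff hs hr hg v.2).1 hv
  · intro h
    exact ⟨u, (mem_orbitA_iff hs hr hg u.2).2 h, rfl⟩

/-! ### Charts of the quotient -/

theorem chart_mem {e : OpenPartialHomeomorph (TorusUniverse Γ (quadrant s r)) AdS3}
    (he : e ∈ torusCharts Γ (quadrant s r)) {x : TorusUniverse Γ (quadrant s r)}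
    (hx : x ∈ e.source) : e x ∈ quadrant s r := by
  obtain ⟨u, -, h⟩ := he x hx
  exact h ▸ u.2

theorem proj_chart {e : OpenPartialHomeomorph (TorusUniverse Γ (quadrant s r)) AdS3}
    (he : e ∈ torusCharts Γ (quadrant s r)) {x : TorusUniverse Γ (quadrant s r)}
    (hx : x ∈ e.source) : proj Γ (quadrant s r) ⟨e x, chart_mem he hx⟩ = x := by
  obtain ⟨u, h, h'⟩ := he x hx
  exact (congrArg _ (Subtype.ext h')).trans h

theorem quotientCoordT_eq_chart (hΓ : Γ ≤ A)
    {e : OpenPartialHomeomorph (TorusUniverse Γ (quadrant s r)) AdS3}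
    (he : e ∈ torusCharts Γ (quadrant s r)) {x : TorusUniverse Γ (quadrant s r)}
    (hx : x ∈ e.source) : quotientCoordT hΓ x = coordT (s * r) (mat (e x)) := by
  conv_lhs => rw [← proj_chart he hx]
  rfl

theorem exists_chart (hΓ : Γ ≤ A) (hd : DiscreteTopology Γ)
    (x : TorusUniverse Γ (quadrant s r)) :
    ∃ e ∈ torusCharts Γ (quadrant s r), x ∈ e.source := by
  let := quadrantAction (s := s) (r := r) hΓ
  obtain ⟨u, rfl⟩ := Quotient.exists_rep x
  obtain ⟨f, hu, hf⟩ :=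
    (isQuotientCoveringMap_proj (s := s) (r := r) hΓ hd).isCoveringMap.isLocalHomeomorph u
  have : Nonempty (quadrant s r) := ⟨u⟩
  refine ⟨f.symm.trans ((isOpen_quadrant s r).isOpenEmbedding_subtypeVal.toOpenPartialHomeomorph _),
    ?_, ?_⟩
  · intro x hx
    have hx' : x ∈ f.target := by simpa using hx
    refine ⟨f.symm x, ?_, rfl⟩
    rw [hf, f.right_inv hx']
  · have : f u ∈ f.target := f.map_source hu
    rw [← hf] at this
    simpa using! this

theorem isSpacetime_torusCharts (hs : s * s = 1) (hr : r * r = 1) (hΓ : Γ ≤ A)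
    (hd : DiscreteTopology Γ) : IsSpacetime (torusCharts Γ (quadrant s r)) := by
  let := quadrantAction (s := s) (r := r) hΓ
  have hq := isQuotientCoveringMap_proj (s := s) (r := r) hΓ hd
  have ho := hq.isOpenQuotientMap
  refine ⟨?_, ?_, ?_, exists_chart hΓ hd, ?_⟩
  · rw [t2Space_iff_of_isOpenQuotientMap ho]
    have hT : Continuous fun u : quadrant s r => coordT (s * r) (mat u.1) :=
      continuousOn_iff_continuous_domRestrict.1 (continuousOn_coords (s * r) s r).1
    have hc := continuous_shift s r
    -- The quotient is Hausdorff because the orbit relation is closed: T agrees at the two points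
    -- and the shift between them lies in the closed set `Γ`.
    have hcl : IsClosed (Γ : Set (AdS3 × AdS3)) := Subgroup.isClosed_of_discrete
    convert! (isClosed_eq (hT.comp continuous_fst) (hT.comp continuous_snd)).inter
      (hcl.preimage hc) using 1
    ext ⟨u, v⟩
    change proj _ _ u = proj _ _ v ↔ coordT (s * r) (mat u.1) = coordT (s * r) (mat v.1) ∧
      flow (coordX (mat v.1) - coordX (mat u.1)) (coordY (mat v.1) - coordY (mat u.1)) ∈ Γ
    rw [proj_eq_iff]
    constructor
    · rintro ⟨z, hz, h⟩
      have := eq_flow_of_act_eq (hΓ hz) u.2 h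
      refine ⟨?_, this ▸ hz⟩
      exact ((mem_orbitA_iff hs hr u.2 v.2).1 ⟨z, hΓ hz, h⟩).symm
    · rintro ⟨h₁, h₂⟩
      exact ⟨_, h₂, act_flow_eq hs hr u.2 v.2 h₁⟩
  · have : SecondCountableTopology AdS3 :=
      inferInstanceAs (SecondCountableTopology {A : Fin 2 → Fin 2 → ℝ // (Matrix.of A).det = 1})
    exact ho.isQuotientMap.secondCountableTopology ho.isOpenMap
  · have := Subtype.connectedSpace (isConnected_quadrant hs hr)
    exact inferInstanceAs (ConnectedSpace (Quotient (orbitSetoid Γ (quadrant s r))))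
  · rintro e he e' he' x ⟨hx, hx'⟩
    obtain ⟨z, -, h⟩ := eventually_act_eq (Γ := Γ) hΓ hd (e.continuousAt hx) (e'.continuousAt hx')
      (chart_mem he hx) (by
        filter_upwards [e.open_source.mem_nhds hx, e'.open_source.mem_nhds hx'] with y hy hy'
        exact proj_eq_iff.1 ((proj_chart he hy).trans (proj_chart he' hy').symm))
    exact ⟨z.1, z.2, h.mono fun y hy => hy.symm⟩

end Lattice

/-! ### Causal vectors in coordinates -/

/-- The derivative of `coordT σ` at `m` in the direction `X`. -/
def velT (σ : ℝ) (m X : Mat) : ℝ :=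
  σ / 2 * (X 0 1 / m 0 1 + X 1 0 / m 1 0 - X 0 0 / m 0 0 - X 1 1 / m 1 1)

/-- The derivative of `coordX` at `m` in the direction `X`. -/
def velX (m X : Mat) : ℝ := (X 0 0 / m 0 0 - X 1 1 / m 1 1) / 2

/-- The derivative of `coordY` at `m` in the direction `X`. -/
def velY (m X : Mat) : ℝ := (X 0 1 / m 0 1 - X 1 0 / m 1 0) / 2

theorem hasDerivAt_coords (σ : ℝ) {c : ℝ → Mat} {t : ℝ} {X : Mat} (hc : HasDerivAt c X t)
    (h₁ : c t 0 0 ≠ 0) (h₂ : c t 0 1 ≠ 0) (h₃ : c t 1 0 ≠ 0) (h₄ : c t 1 1 ≠ 0) :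
    HasDerivAt (fun t => coordT σ (c t)) (velT σ (c t) X) t ∧
      HasDerivAt (fun t => coordX (c t)) (velX (c t) X) t ∧
      HasDerivAt (fun t => coordY (c t)) (velY (c t) X) t := by
  have h : ∀ i j, HasDerivAt (fun t => c t i j) (X i j) t := fun i j =>
    hasDerivAt_pi.1 (hasDerivAt_pi.1 hc i) j
  have l₁ := (h 0 0).log h₁
  have l₂ := (h 0 1).log h₂
  have l₃ := (h 1 0).log h₃
  have l₄ := (h 1 1).log h₄
  exact ⟨(((l₂.add l₃).sub l₁).sub l₄).const_mul (σ / 2), (l₁.sub l₄).div_const 2,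
    (l₂.sub l₃).div_const 2⟩

/-- Cauchy-Schwarz for the weights `P` and `D` of sum `1`. -/
theorem abs_le_of_weighted {P D ξ η K : ℝ} (hP : 0 < P) (hD : 0 < D) (hPD : P + D = 1)
    (h : P * ξ ^ 2 + D * η ^ 2 ≤ P * D * K ^ 2) : |ξ + η| ≤ |K| ∧ |ξ| ≤ |K| ∧ |η| ≤ |K| := by
  have hPD' : 0 < P * D := mul_pos hP hD
  refine ⟨sq_le_sq.1 ?_, sq_le_sq.1 ?_, sq_le_sq.1 ?_⟩
  · refine le_of_mul_le_mul_left ?_ hPD'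
    have : P * D * (ξ + η) ^ 2 + (P * ξ - D * η) ^ 2 = (P + D) * (P * ξ ^ 2 + D * η ^ 2) := by
      have hP1 : P = 1 - D := by linarith
      subst hP1
      ring
    rw [hPD, one_mul] at this
    nlinarith [sq_nonneg (P * ξ - D * η)]
  · refine le_of_mul_le_mul_left ?_ hP
    nlinarith [mul_nonneg hD.le (sq_nonneg η), mul_nonneg (mul_pos hP hP).le (sq_nonneg K)]
  · refine le_of_mul_le_mul_left ?_ hD
    nlinarith [mul_nonneg hP.le (sq_nonneg ξ), mul_nonneg (mul_pos hD hD).le (sq_nonneg K)]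

section Quadrant

variable {s r : ℝ}

/-- The tangent vectors at `g` in terms of the derivatives of the coordinates. -/
theorem tangent_entries (hs : s * s = 1) (hr : r * r = 1) {g : AdS3} (hg : g ∈ quadrant s r)
    {X : Mat} (hX : IsTangent g X) :
    X 0 0 = mat g 0 0 * (s * r * (mat g 0 1 * mat g 1 0) * velT (s * r) (mat g) X +
        velX (mat g) X) ∧
      X 0 1 = mat g 0 1 * (s * r * (mat g 0 0 * mat g 1 1) * velT (s * r) (mat g) X +
        velY (mat g) X) ∧
      X 1 0 = mat g 1 0 * (s * r * (mat g 0 0 * mat g 1 1) * velT (s * r) (mat g) X -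
        velY (mat g) X) ∧
      X 1 1 = mat g 1 1 * (s * r * (mat g 0 1 * mat g 1 0) * velT (s * r) (mat g) X -
        velX (mat g) X) := by
  obtain ⟨h₁, h₂, h₃, h₄⟩ := entries_ne_zero hg
  have hd := mat_det g
  have hsr := sign_mul_sign hs hr
  rw [IsTangent, B_eq] at hX
  simp only [velT, velX, velY]
  generalize s * r = σ at *
  generalize mat g 0 0 = a at *
  generalize mat g 0 1 = b at *
  generalize mat g 1 0 = c at *
  generalize mat g 1 1 = d at *
  -- Logarithmic derivatives of the entries make the three velocities linear without denominators.
  obtain ⟨u, hu⟩ : ∃ u, X 0 0 = a * u := ⟨X 0 0 / a, by field_simp⟩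
  obtain ⟨w, hw⟩ : ∃ u, X 0 1 = b * u := ⟨X 0 1 / b, by field_simp⟩
  obtain ⟨z, hz⟩ : ∃ u, X 1 0 = c * u := ⟨X 1 0 / c, by field_simp⟩
  obtain ⟨v, hv⟩ : ∃ u, X 1 1 = d * u := ⟨X 1 1 / d, by field_simp⟩
  simp only [hu, hw, hz, hv, mul_div_cancel_left₀ _ h₁, mul_div_cancel_left₀ _ h₂,
    mul_div_cancel_left₀ _ h₃, mul_div_cancel_left₀ _ h₄] at hX ⊢
  -- Tangency in these terms. With ad - bc = 1 it gives bc(w + z - u - v) = u + v and ad(w + z - u -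
  -- v) = w + z.
  have ht : b * c * (w + z) = a * d * (u + v) := by linarith
  have k₁ : σ * (b * c) * (σ / 2 * (w + z - u - v)) = (u + v) / 2 := by
    linear_combination (b * c) * (w + z - u - v) / 2 * hsr + ht / 2 + (u + v) / 2 * hd
  have k₂ : σ * (a * d) * (σ / 2 * (w + z - u - v)) = (w + z) / 2 := by
    linear_combination (a * d) * (w + z - u - v) / 2 * hsr + ht / 2 + (w + z) / 2 * hd
  rw [k₁, k₂]
  refine ⟨?_, ?_, ?_, ?_⟩ <;> ring

/-- The metric in coordinates. -/
theorem Q_eq_vel (hs : s * s = 1) (hr : r * r = 1) {g : AdS3} (hg : g ∈ quadrant s r)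
    {X : Mat} (hX : IsTangent g X) :
    Q X = mat g 0 0 * mat g 1 1 * velX (mat g) X ^ 2 +
      -(mat g 0 1 * mat g 1 0) * velY (mat g) X ^ 2 -
      mat g 0 0 * mat g 1 1 * -(mat g 0 1 * mat g 1 0) * velT (s * r) (mat g) X ^ 2 := by
  obtain ⟨h₁, h₂, h₃, h₄⟩ := tangent_entries hs hr hg hX
  have hsr := sign_mul_sign hs hr
  have hd := mat_det g
  rw [Q_eq, h₁, h₂, h₃, h₄]
  generalize velT (s * r) (mat g) X = K
  generalize velX (mat g) X = ξ
  generalize velY (mat g) X = η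
  generalize s * r = σ at *
  generalize mat g 0 0 = a at *
  generalize mat g 0 1 = b at *
  generalize mat g 1 0 = c at *
  generalize mat g 1 1 = d at *
  linear_combination (b * c * (a * d) ^ 2 - a * d * (b * c) ^ 2) * K ^ 2 * hsr +
    a * d * (b * c) * K ^ 2 * hd

/-- The bounds are Cauchy-Schwarz applied to Q ≤ 0. The sign of T' comes from the time orientation:
the pairing with `timeField` would be non-negative if T' ≤ 0, because |X' + Y'| ≤ |T'|. -/
theorem velT_pos (hs : s * s = 1) (hr : r * r = 1) {g : AdS3} (hg : g ∈ quadrant s r) {X : Mat}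
    (hX : IsFutureNonspacelike g X) :
    0 < velT (s * r) (mat g) X ∧ |velX (mat g) X| ≤ velT (s * r) (mat g) X ∧
      |velY (mat g) X| ≤ velT (s * r) (mat g) X := by
  obtain ⟨hX, -, hQ, hB⟩ := hX
  have hP := mul_pos_of_mem hs hg
  have hD := neg_pos.2 (mul_neg_of_mem hr hg)
  have hd := mat_det g
  rw [Q_eq_vel hs hr hg hX] at hQ
  obtain ⟨h₀, hξ, hη⟩ := abs_le_of_weighted hP hD (by linarith) (sub_nonpos.1 hQ)
  suffices 0 < velT (s * r) (mat g) X by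
    rw [abs_of_pos this] at hξ hη
    exact ⟨this, hξ, hη⟩
  obtain ⟨h₁, h₂, h₃, h₄⟩ := tangent_entries hs hr hg hX
  obtain ⟨t₁, t₂, t₃, t₄⟩ := timeField_eq g
  have hsr := sign_mul_sign hs hr
  have hα : 0 < s * r * (mat g 0 1 * mat g 1 1) := by
    have := mul_pos hg.2.1 hg.1.2
    linarith
  have hβ : 0 < -(s * r * (mat g 0 0 * mat g 1 0)) := by
    have := mul_neg_of_pos_of_neg hg.1.1 hg.2.2
    linarith
  rw [B_eq, t₁, t₂, t₃, t₄, h₁, h₂, h₃, h₄] at hB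
  by_contra! hK
  rw [abs_of_nonpos hK, abs_le] at h₀
  clear hQ hξ hη h₁ h₂ h₃ h₄ t₁ t₂ t₃ t₄ hX
  generalize velT (s * r) (mat g) X = K at *
  generalize velX (mat g) X = ξ at *
  generalize velY (mat g) X = η at *
  generalize s * r = σ at *
  generalize mat g 0 0 = a at *
  generalize mat g 0 1 = b at *
  generalize mat g 1 0 = c at *
  generalize mat g 1 1 = d at *
  -- Twice the pairing with `timeField`; the weights σbd and -σac are positive.
  have hB' : -(σ * (b * d)) * (K + σ * (ξ + η)) - -(σ * (a * c)) * (K - σ * (ξ + η)) < 0 := by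
    refine lt_of_eq_of_lt ?_ (show _ < (0 : ℝ) from mul_neg_of_pos_of_neg two_pos hB)
    linear_combination -(b * d + a * c) * (ξ + η) * hsr - σ * K * (a * c - b * d) * hd
  have hK' : K + σ * (ξ + η) ≤ 0 ∧ K - σ * (ξ + η) ≤ 0 := by
    rcases mul_self_eq_one_iff.1 hsr with rfl | rfl <;> constructor <;> linarith
  linarith [mul_nonneg_of_nonpos_of_nonpos (neg_nonpos.2 hα.le) hK'.1,
    mul_nonpos_of_nonneg_of_nonpos hβ.le hK'.2]

theorem IsFutureTimelike.isFutureNonspacelike {g : AdS3} {X : Mat} (h : IsFutureTimelike g X) :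
    IsFutureNonspacelike g X := by
  refine ⟨h.1, ?_, h.2.1.le, h.2.2⟩
  rintro rfl
  have := h.2.1
  simp [Q_eq] at this

end Quadrant

/-! ### Monotonicity with exceptional points -/

/-- Each exceptional point inside the interval is removed by cutting the interval there; continuity
suffices at the cut. -/
theorem lt_of_hasDerivAt_pos_off_finite {f : ℝ → ℝ} (F : Finset ℝ) {a b : ℝ} (hab : a < b)
    (hf : ContinuousOn f (Set.Icc a b))
    (hF : ∀ t ∈ Set.Ioo a b, t ∉ F → ∃ f', HasDerivAt f f' t ∧ 0 < f') : f a < f b := by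
  induction F using Finset.induction_on generalizing a b with
  | empty =>
    refine strictMonoOn_of_deriv_pos (convex_Icc a b) hf ?_ (Set.left_mem_Icc.2 hab.le)
      (Set.right_mem_Icc.2 hab.le) hab
    intro t ht
    rw [interior_Icc] at ht
    obtain ⟨f', h, h'⟩ := hF t ht (by simp)
    rwa [h.deriv]
  | insert c F _ ih =>
    by_cases hc : c ∈ Set.Ioo a b
    · refine (ih hc.1 (hf.mono (Set.Icc_subset_Icc_right hc.2.le)) fun t ht htF => ?_).trans
        (ih hc.2 (hf.mono (Set.Icc_subset_Icc_left hc.1.le)) fun t ht htF => ?_)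
      · refine hF t ⟨ht.1, ht.2.trans hc.2⟩ ?_
        rw [Finset.mem_insert, not_or]
        exact ⟨ht.2.ne, htF⟩
      · refine hF t ⟨hc.1.trans ht.1, ht.2⟩ ?_
        rw [Finset.mem_insert, not_or]
        exact ⟨ht.1.ne', htF⟩
    · refine ih hab hf fun t ht htF => hF t ht ?_
      rw [Finset.mem_insert, not_or]
      refine ⟨?_, htF⟩
      rintro rfl
      exact hc ht

theorem lt_of_hasDerivAt_pos_off {f : ℝ → ℝ} {S : Set ℝ} {a b : ℝ} (hab : a < b)
    (hS : (S ∩ Set.Icc a b).Finite) (hf : ContinuousOn f (Set.Icc a b))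
    (hF : ∀ t ∈ Set.Ioo a b, t ∉ S → ∃ f', HasDerivAt f f' t ∧ 0 < f') : f a < f b :=
  lt_of_hasDerivAt_pos_off_finite hS.toFinset hab hf fun t ht htS =>
    hF t ht fun h => htS (hS.mem_toFinset.2 ⟨h, Set.Ioo_subset_Icc_self ht⟩)

/-- If `|x'| ≤ k'` where `k` is increasing and bounded above, then `x` converges. -/
theorem exists_tendsto_of_monotone {k x : ℝ → ℝ} (h₁ : Monotone fun t => k t + x t)
    (h₂ : Monotone fun t => k t - x t) (hk : BddAbove (Set.range k)) :
    (∃ l, Filter.Tendsto k Filter.atTop (𝓝 l)) ∧ ∃ l, Filter.Tendsto x Filter.atTop (𝓝 l) := by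
  obtain ⟨M, hM⟩ := hk
  have hM' : ∀ t, k t ≤ M := fun t => hM ⟨t, rfl⟩
  have key : ∀ {y z : ℝ → ℝ}, Monotone y → Monotone z → (∀ t, y t + z t = 2 * k t) →
      ∃ l, Filter.Tendsto y Filter.atTop (𝓝 l) := by
    intro y z hy hz hyz
    -- As y + z ≤ 2M and z increases, y ≤ 2M - z(0) on positive parameters; on negative ones y ≤
    -- y(0) gives the same bound.
    refine ⟨_, tendsto_atTop_ciSup hy ⟨2 * M - z 0, ?_⟩⟩
    rintro _ ⟨t, rfl⟩
    rcases le_total 0 t with ht | ht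
    · have := hz ht
      linarith [hyz t, hM' t]
    · have := hy ht
      linarith [hyz 0, hM' 0]
  obtain ⟨l, hl⟩ := key h₁ h₂ fun t => by ring
  obtain ⟨l', hl'⟩ := key h₂ h₁ fun t => by ring
  refine ⟨⟨_, ((hl.add hl').div_const 2).congr fun t => ?_⟩,
    ⟨_, ((hl.sub hl').div_const 2).congr fun t => ?_⟩⟩ <;> ring

/-! ### Causal curves in the quotient -/

section Curves

variable {s r : ℝ} {Γ : Subgroup (AdS3 × AdS3)}

/-- The general `P` covers causal curves, for the Cauchy property, and timelike curves, for the time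
function. -/
theorem quotientCoordT_lt (hs : s * s = 1) (hr : r * r = 1) (hΓ : Γ ≤ A)
    {P : AdS3 → Mat → Prop} (hP : ∀ g X, P g X → IsFutureNonspacelike g X)
    {γ : ℝ → TorusUniverse Γ (quadrant s r)} {I : Set ℝ}
    (hγ : IsCurveOn (torusCharts Γ (quadrant s r)) P γ I) {a b : ℝ} (hab : a < b)
    (hI : Set.Icc a b ⊆ I) : quotientCoordT hΓ (γ a) < quotientCoordT hΓ (γ b) := by
  obtain ⟨hc, S, hS, h⟩ := hγ
  refine lt_of_hasDerivAt_pos_off (f := fun t => quotientCoordT hΓ (γ t)) hab (hS a b)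
    ((continuous_quotientCoordT hΓ).comp_continuousOn (hc.mono hI)) ?_
  intro t ht htS
  have hI' : Set.Ioo a b ⊆ I := Set.Ioo_subset_Icc_self.trans hI
  obtain ⟨e, he, het, X, hX, hPX⟩ := h t (interior_maximal hI' isOpen_Ioo ht) htS
  have hq := chart_mem he het
  obtain ⟨n₁, n₂, n₃, n₄⟩ := entries_ne_zero hq
  refine ⟨_, ((hasDerivAt_coords (s * r) hX n₁ n₂ n₃ n₄).1).congr_of_eventuallyEq ?_,
    (velT_pos hs hr hq (hP _ _ hPX)).1⟩
  have hγt : ContinuousAt γ t :=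
    hc.continuousAt (Filter.mem_of_superset (isOpen_Ioo.mem_nhds ht) hI')
  filter_upwards [hγt (e.open_source.mem_nhds het)] with t' ht'
  exact quotientCoordT_eq_chart hΓ he ht'

theorem exists_lift (hΓ : Γ ≤ A) (hd : DiscreteTopology Γ)
    {γ : ℝ → TorusUniverse Γ (quadrant s r)} (hγ : Continuous γ) :
    ∃ c : ℝ → quadrant s r, Continuous c ∧ ∀ t, proj Γ (quadrant s r) (c t) = γ t := by
  let := quadrantAction (s := s) (r := r) hΓ
  have hcov := (isQuotientCoveringMap_proj (s := s) (r := r) hΓ hd).isCoveringMap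
  obtain ⟨u, hu⟩ := Quotient.exists_rep (γ 0)
  obtain ⟨c, ⟨-, hc⟩, -⟩ := hcov.existsUnique_continuousMap_lifts ⟨γ, hγ⟩ 0 u hu
  exact ⟨c, c.continuous, fun t => congrFun hc t⟩

/-- Along a lift of a future-directed causal curve, the first coordinate bounds the variation of
the other two. -/
theorem exists_monotone_lift (hs : s * s = 1) (hr : r * r = 1) (hΓ : Γ ≤ A)
    (hd : DiscreteTopology Γ) {γ : ℝ → TorusUniverse Γ (quadrant s r)}
    (hγ : IsCurveOn (torusCharts Γ (quadrant s r)) IsFutureNonspacelike γ Set.univ) :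
    ∃ c : ℝ → quadrant s r, (∀ t, proj Γ (quadrant s r) (c t) = γ t) ∧
      (Monotone (fun t => 2 * coordT (s * r) (mat (c t).1) + coordX (mat (c t).1)) ∧
        Monotone (fun t => 2 * coordT (s * r) (mat (c t).1) - coordX (mat (c t).1))) ∧
      Monotone (fun t => 2 * coordT (s * r) (mat (c t).1) + coordY (mat (c t).1)) ∧
        Monotone (fun t => 2 * coordT (s * r) (mat (c t).1) - coordY (mat (c t).1)) := by
  obtain ⟨hγc, S, hS, h⟩ := hγ
  rw [continuousOn_univ] at hγc
  obtain ⟨c, hc, hcγ⟩ := exists_lift hΓ hd hγc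
  have hc' : Continuous fun t => (c t).1 := continuous_subtype_val.comp hc
  have hT : Continuous fun t => coordT (s * r) (mat (c t).1) :=
    (continuousOn_coords (s * r) s r).1.comp_continuous hc' fun t => (c t).2
  have hX : Continuous fun t => coordX (mat (c t).1) :=
    (continuousOn_coords 1 s r).2.1.comp_continuous hc' fun t => (c t).2
  have hY : Continuous fun t => coordY (mat (c t).1) :=
    (continuousOn_coords 1 s r).2.2.comp_continuous hc' fun t => (c t).2
  have hder : ∀ t ∉ S, ∃ k x y, HasDerivAt (fun t => coordT (s * r) (mat (c t).1)) k t ∧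
      HasDerivAt (fun t => coordX (mat (c t).1)) x t ∧
      HasDerivAt (fun t => coordY (mat (c t).1)) y t ∧ 0 < k ∧ |x| ≤ k ∧ |y| ≤ k := by
    intro t ht
    obtain ⟨e, he, het, X, hX, hPX⟩ := h t (by simp) ht
    have hq := chart_mem he het
    have hev : ∀ᶠ t' in 𝓝 t, γ t' ∈ e.source :=
      hγc.continuousAt (e.open_source.mem_nhds het)
    -- The chart lift and the global lift locally differ by one fixed translation, so their
    -- coordinates have the same derivatives.
    obtain ⟨z, hz, hzt⟩ := eventually_act_eq hΓ hd (u := fun t => e (γ t)) (v := fun t => (c t).1)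
      ((e.continuousAt het).comp hγc.continuousAt) hc'.continuousAt hq (by
        filter_upwards [hev] with t' ht'
        exact proj_eq_iff.1 ((proj_chart he ht').trans (hcγ t').symm))
    obtain ⟨x, y, rfl⟩ := mem_A_iff.1 (hΓ hz)
    obtain ⟨n₁, n₂, n₃, n₄⟩ := entries_ne_zero hq
    obtain ⟨d₁, d₂, d₃⟩ := hasDerivAt_coords (s * r) hX n₁ n₂ n₃ n₄
    refine ⟨_, _, _, d₁.congr_of_eventuallyEq ?_, (d₂.const_add x).congr_of_eventuallyEq ?_,
      (d₃.const_add y).congr_of_eventuallyEq ?_, velT_pos hs hr hq hPX⟩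
    · filter_upwards [hzt, hev] with t' h₁ h₂
      rw [← h₁]
      exact (coords_act_flow _ (chart_mem he h₂) x y).1
    · filter_upwards [hzt, hev] with t' h₁ h₂
      rw [← h₁]
      exact (coords_act_flow 1 (chart_mem he h₂) x y).2.1
    · filter_upwards [hzt, hev] with t' h₁ h₂
      rw [← h₁]
      exact (coords_act_flow 1 (chart_mem he h₂) x y).2.2
  have hmono : ∀ {f : ℝ → ℝ}, Continuous f → (∀ t ∉ S, ∃ f', HasDerivAt f f' t ∧ 0 < f') →
      Monotone f := fun hf hf' => StrictMono.monotone fun a b hab =>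
    lt_of_hasDerivAt_pos_off hab (hS a b) hf.continuousOn fun t _ ht => hf' t ht
  -- The factor 2 makes the derivatives strictly positive even where |X'| or |Y'| equals T'.
  refine ⟨c, hcγ, ⟨hmono ((continuous_const.mul hT).add hX) fun t ht => ?_,
    hmono ((continuous_const.mul hT).sub hX) fun t ht => ?_⟩,
    hmono ((continuous_const.mul hT).add hY) fun t ht => ?_,
    hmono ((continuous_const.mul hT).sub hY) fun t ht => ?_⟩ <;>
  obtain ⟨k, x, y, hk, hx, hy, h₀, h₁, h₂⟩ := hder t ht
  · exact ⟨_, (hk.const_mul 2).add hx, by linarith [(abs_le.1 h₁).1]⟩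
  · exact ⟨_, (hk.const_mul 2).sub hx, by linarith [(abs_le.1 h₁).2]⟩
  · exact ⟨_, (hk.const_mul 2).add hy, by linarith [(abs_le.1 h₂).1]⟩
  · exact ⟨_, (hk.const_mul 2).sub hy, by linarith [(abs_le.1 h₂).2]⟩

/-- The coordinates fill ℝ³, so limits of coordinates are coordinates of a point of the quadrant. -/
theorem exists_tendsto_of_tendsto_coords (hs : s * s = 1) (hr : r * r = 1) {l : Filter ℝ}
    {c : ℝ → quadrant s r}
    (hT : ∃ k, Filter.Tendsto (fun t => 2 * coordT (s * r) (mat (c t).1)) l (𝓝 k))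
    (hX : ∃ x, Filter.Tendsto (fun t => coordX (mat (c t).1)) l (𝓝 x))
    (hY : ∃ y, Filter.Tendsto (fun t => coordY (mat (c t).1)) l (𝓝 y)) :
    ∃ q, Filter.Tendsto (fun t => proj Γ (quadrant s r) (c t)) l (𝓝 q) := by
  obtain ⟨k, hk⟩ := hT
  obtain ⟨x, hx⟩ := hX
  obtain ⟨y, hy⟩ := hY
  have hk' : Filter.Tendsto (fun t => coordT (s * r) (mat (c t).1)) l (𝓝 (k / 2)) :=
    (hk.div_const 2).congr fun t => by ring
  have hlim := ((continuous_param hs hr).tendsto (k / 2, x, y)).comp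
    (hk'.prodMk_nhds (hx.prodMk_nhds hy))
  have hlim' : Filter.Tendsto c l
      (𝓝 (⟨param s r hs hr (k / 2) x y, param_mem hs hr _ _ _⟩ : quadrant s r)) := by
    rw [tendsto_subtype_rng]
    exact hlim.congr fun t => param_coords hs hr (c t).2
  have hproj : Continuous (proj Γ (quadrant s r)) := continuous_quot_mk
  exact ⟨_, (hproj.tendsto _).comp hlim'⟩

/-- A future-directed causal curve along which the first coordinate is bounded above has a future
endpoint. -/
theorem exists_tendsto_atTop (hs : s * s = 1) (hr : r * r = 1) (hΓ : Γ ≤ A)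
    (hd : DiscreteTopology Γ) {γ : ℝ → TorusUniverse Γ (quadrant s r)}
    (hγ : IsCurveOn (torusCharts Γ (quadrant s r)) IsFutureNonspacelike γ Set.univ) {M : ℝ}
    (hM : ∀ t, quotientCoordT hΓ (γ t) ≤ M) : ∃ q, Filter.Tendsto γ Filter.atTop (𝓝 q) := by
  obtain ⟨c, hcγ, ⟨h₁, h₂⟩, h₃, h₄⟩ := exists_monotone_lift hs hr hΓ hd hγ
  have hb : BddAbove (Set.range fun t => 2 * coordT (s * r) (mat (c t).1)) := by
    refine ⟨2 * M, ?_⟩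
    rintro _ ⟨t, rfl⟩
    have := hM t
    rw [← hcγ t, quotientCoordT_proj] at this
    exact mul_le_mul_of_nonneg_left this zero_le_two
  obtain ⟨hT, hX⟩ := exists_tendsto_of_monotone h₁ h₂ hb
  obtain ⟨-, hY⟩ := exists_tendsto_of_monotone h₃ h₄ hb
  obtain ⟨q, hq⟩ := exists_tendsto_of_tendsto_coords (Γ := Γ) hs hr hT hX hY
  exact ⟨q, hq.congr hcγ⟩

/-- A future-directed causal curve along which the first coordinate is bounded below has a past
endpoint. -/
theorem exists_tendsto_atBot (hs : s * s = 1) (hr : r * r = 1) (hΓ : Γ ≤ A)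
    (hd : DiscreteTopology Γ) {γ : ℝ → TorusUniverse Γ (quadrant s r)}
    (hγ : IsCurveOn (torusCharts Γ (quadrant s r)) IsFutureNonspacelike γ Set.univ) {M : ℝ}
    (hM : ∀ t, M ≤ quotientCoordT hΓ (γ t)) : ∃ q, Filter.Tendsto γ Filter.atBot (𝓝 q) := by
  obtain ⟨c, hcγ, ⟨h₁, h₂⟩, h₃, h₄⟩ := exists_monotone_lift hs hr hΓ hd hγ
  have hb : BddAbove (Set.range fun t => -(2 * coordT (s * r) (mat (c (-t)).1))) := by
    refine ⟨-(2 * M), ?_⟩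
    rintro _ ⟨t, rfl⟩
    have := hM (-t)
    rw [← hcγ (-t), quotientCoordT_proj] at this
    exact neg_le_neg (mul_le_mul_of_nonneg_left this zero_le_two)
  -- Reversing the parameter and the sign of T reduces the past end to the future one.
  have rev : ∀ {k x : ℝ → ℝ}, Monotone (fun t => k t + x t) →
      Monotone fun t => -k (-t) - x (-t) := by
    intro k x h a b hab
    have := h (neg_le_neg hab)
    dsimp only at this ⊢
    linarith
  have rev' : ∀ {k x : ℝ → ℝ}, Monotone (fun t => k t - x t) →
      Monotone fun t => -k (-t) + x (-t) := by
    intro k x h a b hab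
    have := h (neg_le_neg hab)
    dsimp only at this ⊢
    linarith
  have back : ∀ {f : ℝ → ℝ}, (∃ l, Filter.Tendsto (fun t => f (-t)) Filter.atTop (𝓝 l)) →
      ∃ l, Filter.Tendsto f Filter.atBot (𝓝 l) := by
    rintro f ⟨l, hl⟩
    refine ⟨l, (hl.comp Filter.tendsto_neg_atBot_atTop).congr fun t => ?_⟩
    simp
  obtain ⟨⟨k, hk⟩, hX⟩ := exists_tendsto_of_monotone (rev' h₂) (rev h₁) hb
  obtain ⟨-, hY⟩ := exists_tendsto_of_monotone (rev' h₄) (rev h₃) hb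
  obtain ⟨q, hq⟩ := exists_tendsto_of_tendsto_coords (Γ := Γ) hs hr
    (back (f := fun t => 2 * coordT (s * r) (mat (c t).1))
      ⟨-k, hk.neg.congr fun t => neg_neg _⟩)
    (back (f := fun t => coordX (mat (c t).1)) hX) (back (f := fun t => coordY (mat (c t).1)) hY)
  exact ⟨q, hq.congr hcγ⟩

/-- Inextendable future-directed causal curves meet each level of the first coordinate once. -/
theorem existsUnique_quotientCoordT_eq (hs : s * s = 1) (hr : r * r = 1) (hΓ : Γ ≤ A)
    (hd : DiscreteTopology Γ) {γ : ℝ → TorusUniverse Γ (quadrant s r)}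
    (hγ : IsCurveOn (torusCharts Γ (quadrant s r)) IsFutureNonspacelike γ Set.univ)
    (htop : ¬ ∃ x, Filter.Tendsto γ Filter.atTop (𝓝 x))
    (hbot : ¬ ∃ x, Filter.Tendsto γ Filter.atBot (𝓝 x)) (k : ℝ) :
    ∃! t, quotientCoordT hΓ (γ t) = k := by
  have hmono : StrictMono fun t => quotientCoordT hΓ (γ t) := fun a b hab =>
    quotientCoordT_lt hs hr hΓ (fun _ _ h => h) hγ hab (Set.subset_univ _)
  have hcont : Continuous fun t => quotientCoordT hΓ (γ t) :=
    (continuous_quotientCoordT hΓ).comp (continuousOn_univ.1 hγ.1)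
  have h₁ : ∃ t, k ≤ quotientCoordT hΓ (γ t) := by
    by_contra! h
    exact htop (exists_tendsto_atTop hs hr hΓ hd hγ fun t => (h t).le)
  have h₂ : ∃ t, quotientCoordT hΓ (γ t) ≤ k := by
    by_contra! h
    exact hbot (exists_tendsto_atBot hs hr hΓ hd hγ fun t => (h t).le)
  obtain ⟨t₁, h₁⟩ := h₁
  obtain ⟨t₂, h₂⟩ := h₂
  obtain ⟨t, ht⟩ := mem_range_of_exists_le_of_exists_ge hcont ⟨t₂, h₂⟩ ⟨t₁, h₁⟩
  exact ⟨t, ht, fun t' ht' => hmono.injective (ht'.trans ht.symm)⟩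

end Curves

/-! ### The level surfaces of the first coordinate -/

section Surfaces

variable {s r : ℝ} {Γ : Subgroup (AdS3 × AdS3)}

/-- P = 1 / (1 + e^{2σT}) is injective in T, so the levels have the polynomial equation ad =
constant. -/
theorem coordT_eq_iff (hs : s * s = 1) (hr : r * r = 1) {g h : AdS3} (hg : g ∈ quadrant s r)
    (hh : h ∈ quadrant s r) : coordT (s * r) (mat g) = coordT (s * r) (mat h) ↔
      mat g 0 0 * mat g 1 1 = mat h 0 0 * mat h 1 1 := by
  have hd := mat_det g
  have hd' := mat_det h
  have e := exp_coordT hs hr hg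
  have e' := exp_coordT hs hr hh
  constructor
  · intro hk
    rw [hk] at e
    generalize Real.exp (s * r * coordT (s * r) (mat h)) = E at e e'
    have hE : 1 + E * E ≠ 0 := by nlinarith [mul_self_nonneg E]
    exact mul_right_cancel₀ hE (by linarith)
  · intro hP
    have hb : mat g 0 1 * mat g 1 0 = mat h 0 1 * mat h 1 0 := by linarith
    rw [hP, hb, ← e'] at e
    have := mul_left_cancel₀ (mul_pos_of_mem hs hh).ne' e
    rw [mul_self_inj_of_nonneg (Real.exp_pos _).le (Real.exp_pos _).le, Real.exp_eq_exp] at this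
    refine mul_left_cancel₀ (left_ne_zero_of_mul (a := s * r) (b := s * r) ?_) this
    rw [sign_mul_sign hs hr]
    exact one_ne_zero

theorem fderiv_apply_eq {E : Type*} [NormedAddCommGroup E] [NormedSpace ℝ E] {f : Mat → E}
    {m X : Mat} {v : E} (hf : DifferentiableAt ℝ f m)
    (h : HasDerivAt (fun t : ℝ => f (m + t • X)) v 0) : fderiv ℝ f m X = v := by
  rw [← hf.lineDeriv_eq_fderiv]
  exact HasLineDerivAt.lineDeriv h

theorem hasDerivAt_line (m X : Mat) : HasDerivAt (fun t : ℝ => m + t • X) X 0 := by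
  simpa using ((hasDerivAt_id (0 : ℝ)).smul_const X).const_add m

/-- With T' = 0 the metric reduces to P X'² + D Y'², which is positive definite. -/
theorem isSpacelikeSurface_level (hs : s * s = 1) (hr : r * r = 1) (hΓ : Γ ≤ A)
    (hd : DiscreteTopology Γ) (k : ℝ) :
    IsSpacelikeSurface (torusCharts Γ (quadrant s r)) {q | quotientCoordT hΓ q = k} := by
  intro p hp
  obtain ⟨e, he, hpe⟩ := exists_chart hΓ hd p
  have hf : ContDiff ℝ ∞ fun m : Mat => m 0 0 * m 1 1 - mat (e p) 0 0 * mat (e p) 1 1 := by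
    fun_prop
  refine ⟨e, he, hpe, Set.univ, _, isOpen_univ, Set.mem_univ _, hf.contDiffOn, ?_⟩
  intro q hq _
  have hqm := chart_mem he hq
  have hk : coordT (s * r) (mat (e p)) = k := by rw [← quotientCoordT_eq_chart hΓ he hpe]; exact hp
  refine ⟨?_, ?_⟩
  · change quotientCoordT hΓ q = k ↔ _
    rw [quotientCoordT_eq_chart hΓ he hq, ← hk, coordT_eq_iff hs hr hqm (chart_mem he hpe),
      sub_eq_zero]
  · intro _ X hX hX0 hdf
    rw [fderiv_apply_eq (v := X 0 0 * mat (e q) 1 1 + mat (e q) 0 0 * X 1 1)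
      (hf.differentiable (by simp)).differentiableAt] at hdf
    · obtain ⟨h₁, h₂, h₃, h₄⟩ := tangent_entries hs hr hqm hX
      have hP := mul_pos_of_mem hs hqm
      have hD := neg_pos.2 (mul_neg_of_mem hr hqm)
      have hsr : s * r ≠ 0 := left_ne_zero_of_mul (b := s * r) (by
        rw [sign_mul_sign hs hr]
        exact one_ne_zero)
      -- The derivative of ad along a tangent vector is 2σ(ad)(bc)T', with non-zero factor.
      have hK : velT (s * r) (mat (e q)) X = 0 := by
        have : 2 * (s * r) * (mat (e q) 0 0 * mat (e q) 1 1) * (mat (e q) 0 1 * mat (e q) 1 0) *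
            velT (s * r) (mat (e q)) X = 0 := by
          rw [← hdf, h₁, h₄]
          ring
        have hD' : mat (e q) 0 1 * mat (e q) 1 0 ≠ 0 := neg_ne_zero.1 hD.ne'
        have hc := mul_ne_zero (mul_ne_zero (mul_ne_zero two_ne_zero hsr) hP.ne') hD'
        exact (mul_eq_zero.1 this).resolve_left hc
      rw [Q_eq_vel hs hr hqm hX]
      rw [hK] at h₁ h₂ h₃ h₄ ⊢
      have hne : velX (mat (e q)) X ≠ 0 ∨ velY (mat (e q)) X ≠ 0 := by
        by_contra! h
        rw [h.1] at h₁ h₄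
        rw [h.2] at h₂ h₃
        refine hX0 (mat_ext ?_ ?_ ?_ ?_) <;> simp [h₁, h₂, h₃, h₄]
      rcases hne with h | h
      · have := mul_pos hP (sq_pos_of_ne_zero h)
        have := mul_nonneg hD.le (sq_nonneg (velY (mat (e q)) X))
        linarith
      · have := mul_nonneg hP.le (sq_nonneg (velX (mat (e q)) X))
        have := mul_pos hD (sq_pos_of_ne_zero h)
        linarith
    · have h : ∀ i j, HasDerivAt (fun t : ℝ => (mat (e q) + t • X) i j) (X i j) 0 := fun i j =>
        hasDerivAt_pi.1 (hasDerivAt_pi.1 (hasDerivAt_line (mat (e q)) X) i) j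
      simpa using ((h 0 0).mul (h 1 1)).sub_const (mat (e p) 0 0 * mat (e p) 1 1)

/-! ### Unit normal and mean curvature of the levels -/

/-- The linear field restricting to the unit normal of a level surface, where `κ` is the slope of
the rotation in the level. -/
def normalField (κ : ℝ) : Mat →L[ℝ] Mat :=
  LinearMap.toContinuousLinearMap
    { toFun := fun m => ![![-κ * m 0 0, κ⁻¹ * m 0 1], ![κ⁻¹ * m 1 0, -κ * m 1 1]]
      map_add' := fun m m' => by apply mat_ext <;> simp <;> ring
      map_smul' := fun c m => by apply mat_ext <;> simp <;> ring }

theorem normalField_apply (κ : ℝ) (m : Mat) :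
    normalField κ m = ![![-κ * m 0 0, κ⁻¹ * m 0 1], ![κ⁻¹ * m 1 0, -κ * m 1 1]] := rfl

theorem sign_mul_exp_sq (hs : s * s = 1) (hr : r * r = 1) {g : AdS3} (hg : g ∈ quadrant s r) :
    (s * r * Real.exp (s * r * coordT (s * r) (mat g))) ^ 2 * (mat g 0 0 * mat g 1 1) =
      -(mat g 0 1 * mat g 1 0) := by
  rw [← exp_coordT hs hr hg]
  linear_combination Real.exp (s * r * coordT (s * r) (mat g)) ^ 2 *
    (mat g 0 0 * mat g 1 1) * sign_mul_sign hs hr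

/-- All follows from κ²P = D: the norm is -κ²P - κ⁻²D = -D - P = -1, and tangency is κP = κ⁻¹D. The
sign of κ makes the field future-pointing. -/
theorem isFutureTimelike_normalField (hs : s * s = 1) (hr : r * r = 1) {g : AdS3}
    (hg : g ∈ quadrant s r) :
    IsFutureTimelike g (normalField (s * r * Real.exp (s * r * coordT (s * r) (mat g))) (mat g)) ∧
      Q (normalField (s * r * Real.exp (s * r * coordT (s * r) (mat g))) (mat g)) = -1 := by
  have hκ := sign_mul_exp_sq hs hr hg
  have hE := Real.exp_pos (s * r * coordT (s * r) (mat g))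
  have hsr := sign_mul_sign hs hr
  have hd := mat_det g
  obtain ⟨t₁, t₂, t₃, t₄⟩ := timeField_eq g
  have hα : 0 < s * r * (mat g 0 1 * mat g 1 1) := by
    have := mul_pos hg.2.1 hg.1.2
    linarith
  have hβ : 0 < -(s * r * (mat g 0 0 * mat g 1 0)) := by
    have := mul_neg_of_pos_of_neg hg.1.1 hg.2.2
    linarith
  generalize Real.exp (s * r * coordT (s * r) (mat g)) = E at *
  have hκ0 : s * r * E ≠ 0 := by
    refine mul_ne_zero (left_ne_zero_of_mul (b := s * r) ?_) hE.ne'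
    rw [hsr]
    exact one_ne_zero
  have hκi : (s * r * E)⁻¹ = s * r * E⁻¹ := by
    rw [mul_inv, inv_eq_of_mul_eq_one_right hsr]
  have hB : B (normalField (s * r * E) (mat g)) (timeField g) < 0 := by
    rw [B_eq, normalField_apply, t₁, t₂, t₃, t₄, hκi]
    have h := mul_pos (add_pos hE (inv_pos.2 hE)) (add_pos hα hβ)
    simp
    linarith
  clear hE hα hβ hκi t₁ t₂ t₃ t₄
  generalize s * r * E = κ at *
  have hi : κ⁻¹ * κ = 1 := inv_mul_cancel₀ hκ0
  have hQ : Q (normalField κ (mat g)) = -1 := by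
    rw [Q_eq, normalField_apply]
    change κ⁻¹ * mat g 0 1 * (κ⁻¹ * mat g 1 0) - -κ * mat g 0 0 * (-κ * mat g 1 1) = -1
    linear_combination (κ⁻¹ ^ 2 - 1) * hκ - mat g 0 0 * mat g 1 1 * (κ⁻¹ * κ + 1) * hi - hd
  refine ⟨⟨?_, by rw [hQ]; norm_num, hB⟩, hQ⟩
  rw [IsTangent, B_eq, normalField_apply]
  change (mat g 0 1 * (κ⁻¹ * mat g 1 0) + κ⁻¹ * mat g 0 1 * mat g 1 0 -
    mat g 0 0 * (-κ * mat g 1 1) - -κ * mat g 0 0 * mat g 1 1) / 2 = 0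
  linear_combination κ⁻¹ * hκ - κ * (mat g 0 0 * mat g 1 1) * hi

/-- The velocities come from one-parameter subgroups of `A`, which preserve T; the curve stays in
the chart for small times. -/
theorem isTangentTo_orbit (hΓ : Γ ≤ A) {k : ℝ}
    {e : OpenPartialHomeomorph (TorusUniverse Γ (quadrant s r)) AdS3}
    (he : e ∈ torusCharts Γ (quadrant s r)) {p : TorusUniverse Γ (quadrant s r)}
    (hp : p ∈ e.source) (hk : quotientCoordT hΓ p = k) (ξ η : ℝ) :
    IsTangentTo (e '' (e.source ∩ {q | quotientCoordT hΓ q = k})) (e p)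
      ![![ξ * mat (e p) 0 0, η * mat (e p) 0 1], ![-η * mat (e p) 1 0, -ξ * mat (e p) 1 1]] := by
  have hflow : ∀ t : ℝ, (gpow ((ξ + η) / 2 * t), gpow ((η - ξ) / 2 * t)) = flow (ξ * t) (η * t) := by
    intro t
    rw [flow]
    congr 2 <;> ring
  have hc := hasDerivAt_act_gpow ((ξ + η) / 2) ((η - ξ) / 2) (e p)
  simp only [hflow] at hc
  rw [show (ξ + η) / 2 - (η - ξ) / 2 = ξ by ring, show (ξ + η) / 2 + (η - ξ) / 2 = η by ring] at hc
  have hcont : Continuous fun t : ℝ => act (flow (ξ * t) (η * t)) (e p) := by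
    have : Continuous fun t : ℝ => flow (ξ * t) (η * t) :=
      continuous_flow.comp (f := fun t : ℝ => (ξ * t, η * t)) (by fun_prop)
    exact (this.fst.mul continuous_const).mul this.snd.inv
  have h0 : act (flow (ξ * 0) (η * 0)) (e p) = e p := by
    rw [mul_zero, mul_zero, flow_zero, act_one]
  refine ⟨fun t => act (flow (ξ * t) (η * t)) (e p), h0, ?_, hc⟩
  have ht : ∀ᶠ t : ℝ in 𝓝 0, act (flow (ξ * t) (η * t)) (e p) ∈ e.target :=
    hcont.continuousAt (e.open_target.mem_nhds (by simpa only [h0] using e.map_source hp))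
  filter_upwards [ht] with t ht
  have hsrc := e.map_target ht
  refine ⟨e.symm (act (flow (ξ * t) (η * t)) (e p)), ⟨hsrc, ?_⟩, e.right_inv ht⟩
  change quotientCoordT hΓ _ = k
  rw [quotientCoordT_eq_chart hΓ he hsrc, e.right_inv ht,
    (coords_act_flow _ (chart_mem he hp) _ _).1, ← quotientCoordT_eq_chart hΓ he hp, hk]

/-- The normal field is orthogonal to the level surfaces. -/
theorem B_normalField_eq_zero (hs : s * s = 1) (hr : r * r = 1) (κ : ℝ) {S : Set AdS3} {g : AdS3}
    (hg : g ∈ quadrant s r)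
    (hS : ∀ h ∈ S, h ∈ quadrant s r ∧ coordT (s * r) (mat h) = coordT (s * r) (mat g))
    {X : Mat} (hX : IsTangentTo S g X) : B (normalField κ (mat g)) X = 0 := by
  obtain ⟨c, rfl, hcS, hc⟩ := hX
  have h : ∀ i j, HasDerivAt (fun t => mat (c t) i j) (X i j) 0 := fun i j =>
    hasDerivAt_pi.1 (hasDerivAt_pi.1 hc i) j
  -- Both ad and bc are constant along the curve; the pairing is a combination of their derivatives
  -- with coefficients κ and κ⁻¹, up to a factor.
  have hP : ∀ᶠ t in 𝓝 0, mat (c t) 0 0 * mat (c t) 1 1 = mat (c 0) 0 0 * mat (c 0) 1 1 := by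
    filter_upwards [hcS] with t ht
    exact (coordT_eq_iff hs hr (hS _ ht).1 hg).1 (hS _ ht).2
  have hD : ∀ᶠ t in 𝓝 0, mat (c t) 0 1 * mat (c t) 1 0 = mat (c 0) 0 1 * mat (c 0) 1 0 := by
    filter_upwards [hP] with t ht
    linarith [mat_det (c t), mat_det (c 0)]
  have d₁ : X 0 0 * mat (c 0) 1 1 + mat (c 0) 0 0 * X 1 1 = 0 :=
    ((h 0 0).mul (h 1 1)).unique ((hasDerivAt_const (0 : ℝ) _).congr_of_eventuallyEq hP)
  have d₂ : X 0 1 * mat (c 0) 1 0 + mat (c 0) 0 1 * X 1 0 = 0 :=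
    ((h 0 1).mul (h 1 0)).unique ((hasDerivAt_const (0 : ℝ) _).congr_of_eventuallyEq hD)
  rw [B_eq, normalField_apply]
  simp
  linear_combination κ * d₁ + κ⁻¹ * d₂

/-- The X and Y directions, normalised by √P and √D, are eigenvectors of the linear normal field
with eigenvalues -κ and κ⁻¹, so the trace is κ - κ⁻¹. -/
theorem isCMCSurface_level (hs : s * s = 1) (hr : r * r = 1) (hΓ : Γ ≤ A)
    (hd : DiscreteTopology Γ) (k : ℝ) :
    IsCMCSurface (torusCharts Γ (quadrant s r)) {q | quotientCoordT hΓ q = k}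
      (2 * Real.sinh k) := by
  refine ⟨isSpacelikeSurface_level hs hr hΓ hd k, ?_⟩
  intro p hp
  obtain ⟨e, he, hpe⟩ := exists_chart hΓ hd p
  have hg := chart_mem he hpe
  have hP := mul_pos_of_mem hs hg
  have hD := neg_pos.2 (mul_neg_of_mem hr hg)
  have hk : ∀ q ∈ e.source, quotientCoordT hΓ q = k → coordT (s * r) (mat (e q)) = k :=
    fun q hq h => by rw [← quotientCoordT_eq_chart hΓ he hq, h]
  set κ := s * r * Real.exp (s * r * k) with hκ
  refine ⟨e, he, hpe, Set.univ, normalField κ, isOpen_univ, Set.mem_univ _,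
    (normalField κ).contDiff.contDiffOn, ?_, _, _,
    isTangentTo_orbit hΓ he hpe hp (√(mat (e p) 0 0 * mat (e p) 1 1))⁻¹ 0,
    isTangentTo_orbit hΓ he hpe hp 0 (√(-(mat (e p) 0 1 * mat (e p) 1 0)))⁻¹, ?_, ?_, ?_, ?_⟩
  · intro q hq hqk _
    have hm := chart_mem he hq
    have hN := isFutureTimelike_normalField hs hr hm
    rw [hk q hq hqk, ← hκ] at hN
    refine ⟨hN.1, hN.2, fun X hX => B_normalField_eq_zero hs hr κ hm ?_ hX⟩
    rintro _ ⟨q', ⟨hq', hqk'⟩, rfl⟩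
    exact ⟨chart_mem he hq', (hk q' hq' hqk').trans (hk q hq hqk).symm⟩
  all_goals
    have h₁ : (√(mat (e p) 0 0 * mat (e p) 1 1))⁻¹ * (√(mat (e p) 0 0 * mat (e p) 1 1))⁻¹ *
        (mat (e p) 0 0 * mat (e p) 1 1) = 1 := by
      rw [← mul_inv, Real.mul_self_sqrt hP.le, inv_mul_cancel₀ hP.ne']
    have h₂ : (√(-(mat (e p) 0 1 * mat (e p) 1 0)))⁻¹ * (√(-(mat (e p) 0 1 * mat (e p) 1 0)))⁻¹ *
        -(mat (e p) 0 1 * mat (e p) 1 0) = 1 := by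
      rw [← mul_inv, Real.mul_self_sqrt hD.le, inv_mul_cancel₀ hD.ne']
    generalize (√(mat (e p) 0 0 * mat (e p) 1 1))⁻¹ = ξ at *
    generalize (√(-(mat (e p) 0 1 * mat (e p) 1 0)))⁻¹ = η at *
  · rw [Q_eq]
    simp
    linear_combination h₁
  · rw [Q_eq]
    simp
    linear_combination h₂
  · rw [B_eq]
    simp
  · rw [← sinh_eq_of_sign (sign_mul_sign hs hr), ← hκ]
    simp only [covDeriv, tangentProj, ContinuousLinearMap.fderiv, normalField_apply, B_eq]
    simp
    linear_combination (-κ) * h₁ + κ⁻¹ * h₂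

/-! ### Cauchy property of the levels -/

theorem isCauchySurface_level (hs : s * s = 1) (hr : r * r = 1) (hΓ : Γ ≤ A)
    (hd : DiscreteTopology Γ) (k : ℝ) :
    IsCauchySurface (torusCharts Γ (quadrant s r)) {q | quotientCoordT hΓ q = k} := by
  refine ⟨isSpacelikeSurface_level hs hr hΓ hd k, ?_⟩
  rintro γ ⟨hγ | hγ, htop, hbot⟩
  · exact existsUnique_quotientCoordT_eq hs hr hΓ hd hγ htop hbot k
  -- For a past-directed curve, reversing the parameter exchanges the two ends.
  · obtain ⟨t, ht, huniq⟩ := existsUnique_quotientCoordT_eq hs hr hΓ hd hγ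
      (fun ⟨x, hx⟩ => hbot ⟨x, (hx.comp Filter.tendsto_neg_atBot_atTop).congr fun t => by simp⟩)
      (fun ⟨x, hx⟩ => htop ⟨x, (hx.comp Filter.tendsto_neg_atTop_atBot).congr fun t => by simp⟩) k
    refine ⟨-t, ht, fun t' ht' => ?_⟩
    have := huniq (-t') (by simpa using! ht')
    linarith

/-! ### The time function -/

theorem isSubmersion_sinh (hs : s * s = 1) (hr : r * r = 1) (hΓ : Γ ≤ A)
    (hd : DiscreteTopology Γ) :
    IsSubmersion (torusCharts Γ (quadrant s r)) fun q => 2 * Real.sinh (quotientCoordT hΓ q) := by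
  intro p
  obtain ⟨e, he, hpe⟩ := exists_chart hΓ hd p
  have hg := chart_mem he hpe
  obtain ⟨n₁, n₂, n₃, n₄⟩ := entries_ne_zero hg
  have hW : ∀ i j, IsOpen {m : Mat | m i j ≠ 0} := fun i j =>
    isOpen_ne_fun (by fun_prop) continuous_const
  have hW' := ((hW 0 0).inter (hW 0 1)).inter ((hW 1 0).inter (hW 1 1))
  have hF : ContDiffOn ℝ ∞ (fun m : Mat => 2 * Real.sinh (coordT (s * r) m))
      (({m | m 0 0 ≠ 0} ∩ {m | m 0 1 ≠ 0}) ∩ ({m | m 1 0 ≠ 0} ∩ {m | m 1 1 ≠ 0})) := by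
    have hl : ∀ i j, ContDiff ℝ ∞ fun m : Mat => m i j := fun i j => by fun_prop
    refine contDiffOn_const.mul (ContDiffOn.sinh (contDiffOn_const.mul ?_))
    exact (((((hl 0 1).contDiffOn.log fun m hm => hm.1.2).add
      ((hl 1 0).contDiffOn.log fun m hm => hm.2.1)).sub
      ((hl 0 0).contDiffOn.log fun m hm => hm.1.1)).sub
      ((hl 1 1).contDiffOn.log fun m hm => hm.2.2))
  have hmem : mat (e p) ∈ (({m : Mat | m 0 0 ≠ 0} ∩ {m | m 0 1 ≠ 0}) ∩
      ({m | m 1 0 ≠ 0} ∩ {m | m 1 1 ≠ 0})) := ⟨⟨n₁, n₂⟩, n₃, n₄⟩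
  refine ⟨e, he, hpe, _, _, hW', hmem, hF, ?_, ?_⟩
  · intro q hq _
    simp only [quotientCoordT_eq_chart hΓ he hq]
  -- The tangent vector with X' = Y' = 0 and T' = σ, read off from `tangent_entries`.
  · set X : Mat := ![![mat (e p) 0 0 * (mat (e p) 0 1 * mat (e p) 1 0),
      mat (e p) 0 1 * (mat (e p) 0 0 * mat (e p) 1 1)],
      ![mat (e p) 1 0 * (mat (e p) 0 0 * mat (e p) 1 1),
      mat (e p) 1 1 * (mat (e p) 0 1 * mat (e p) 1 0)]] with hX
    refine ⟨X, ?_, ?_⟩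
    · rw [IsTangent, B_eq]
      simp [hX]
      ring
    · have hv : velT (s * r) (mat (e p)) X = s * r := by
        simp only [velT, hX]
        simp [mul_div_cancel_left₀, n₁, n₂, n₃, n₄]
        linear_combination s * r * mat_det (e p)
      have hline := (hasDerivAt_coords (s * r) (hasDerivAt_line (mat (e p)) X) (by simpa using n₁)
        (by simpa using n₂) (by simpa using n₃) (by simpa using n₄)).1
      rw [fderiv_apply_eq ((hF.differentiableOn (by simp)).differentiableAt (hW'.mem_nhds hmem))
        (hline.sinh.const_mul 2)]
      simp only [zero_smul, add_zero, hv]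
      refine mul_ne_zero two_ne_zero (mul_ne_zero (Real.cosh_pos _).ne'
        (left_ne_zero_of_mul (b := s * r) ?_))
      rw [sign_mul_sign hs hr]
      exact one_ne_zero

/-- The fiber over H is the level T = arsinh (H / 2), whose mean curvature 2 sinh T is H. -/
theorem isCMCTimeFunction_sinh (hs : s * s = 1) (hr : r * r = 1) (hΓ : Γ ≤ A)
    (hd : DiscreteTopology Γ) :
    IsCMCTimeFunction (torusCharts Γ (quadrant s r))
      fun q => 2 * Real.sinh (quotientCoordT hΓ q) := by
  refine ⟨⟨isSubmersion_sinh hs hr hΓ hd, fun γ a b hab hγ => ?_⟩, fun H => ?_⟩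
  · have := quotientCoordT_lt hs hr hΓ (fun _ _ h => h.isFutureNonspacelike) hγ hab subset_rfl
    exact mul_lt_mul_of_pos_left (Real.sinh_lt_sinh.2 this) two_pos
  · have h := isCMCSurface_level hs hr hΓ hd (Real.arsinh (H / 2))
    rw [Real.sinh_arsinh, mul_div_cancel₀ _ two_ne_zero] at h
    convert h using 1
    ext q
    change 2 * Real.sinh _ = H ↔ quotientCoordT hΓ q = _
    rw [← Real.sinh_inj (x := quotientCoordT hΓ q), Real.sinh_arsinh, eq_div_iff two_ne_zero, mul_comm]

end Surfaces

end AdS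

end

theorem theoremp (Γ : Subgroup (AdS.AdS3 × AdS.AdS3)) (hΓ : AdS.IsLatticeOfA Γ)
    (U : Set AdS.AdS3) (hU : AdS.IsComponentOfOmega U) :
    (∀ x ∈ Γ, AdS.act x '' U = U) ∧
    AdS.IsSpacetime (AdS.torusCharts Γ U) ∧
    AdS.IsGloballyHyperbolic (AdS.torusCharts Γ U) ∧
    (∀ g ∈ U, AdS.orbitA g ⊆ U ∧
      (∃! θ : ℝ, θ ∈ Set.Ico 0 (2 * Real.pi) ∧ AdS.rot θ ∈ AdS.orbitA g) ∧
      AdS.IsCauchySurface (AdS.torusCharts Γ U) (AdS.orbitImage Γ U g) ∧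
      ∀ θ : ℝ, AdS.rot θ ∈ AdS.orbitA g →
        AdS.IsCMCSurface (AdS.torusCharts Γ U) (AdS.orbitImage Γ U g)
          (-2 * Real.cot (2 * θ))) ∧
    ∃ τ : AdS.TorusUniverse Γ U → ℝ,
      AdS.IsCMCTimeFunction (AdS.torusCharts Γ U) τ ∧
      ∀ (u : U) (θ : ℝ), AdS.rot θ ∈ AdS.orbitA u.1 →
        τ (AdS.proj Γ U u) = -2 * Real.cot (2 * θ) := by
  obtain ⟨s, r, hs, hr, rfl⟩ := AdS.eq_quadrant_of_isComponentOfOmega hU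
  obtain ⟨hle, hd, -⟩ := hΓ
  -- A rotation in the orbit of `g` has the same T as `g`, which turns the cotangent into a function
  -- of T.
  have hcot : ∀ g ∈ AdS.quadrant s r, ∀ θ : ℝ, AdS.rot θ ∈ AdS.orbitA g →
      -2 * Real.cot (2 * θ) = 2 * Real.sinh (AdS.coordT (s * r) (AdS.mat g)) := by
    intro g hg θ hθ
    have hm := AdS.orbitA_subset hg hθ
    rw [AdS.neg_two_cot_eq hs hr hm, (AdS.mem_orbitA_iff hs hr hg hm).1 hθ]
  refine ⟨fun x hx => ?_, AdS.isSpacetime_torusCharts hs hr hle hd,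
    ⟨_, AdS.isCauchySurface_level hs hr hle hd 0⟩, fun g hg => ⟨AdS.orbitA_subset hg,
      AdS.existsUnique_rot_mem_orbitA hs hr hg, ?_, fun θ hθ => ?_⟩,
    _, AdS.isCMCTimeFunction_sinh hs hr hle hd, fun u θ hθ => (hcot u.1 u.2 θ hθ).symm⟩
  · refine Set.Subset.antisymm ?_ fun g hg => ⟨AdS.act x⁻¹ g,
      AdS.act_mem_of_mem_A (hle (Γ.inv_mem hx)) hg, ?_⟩
    · rintro _ ⟨g, hg, rfl⟩
      exact AdS.act_mem_of_mem_A (hle hx) hg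
    · rw [← AdS.act_mul, mul_inv_cancel, AdS.act_one]
  · rw [AdS.orbitImage_eq hs hr hle hg]
    exact AdS.isCauchySurface_level hs hr hle hd _
  · rw [AdS.orbitImage_eq hs hr hle hg, hcot g hg θ hθ]
    exact AdS.isCMCSurface_level hs hr hle hd _
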